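/- **Window functions.** For $m\in\mathbb N$, $m\ge 2$, and $\sigma>1$ let $\Omega(m,\sigma)$ be the set of continuous even functions $\omega:\mathbb R\to[0,1]$ with support $[-1,1]$ and $\omega(0)=1$ that are decreasing on $[0,1]$ and whose Fourier transform $\hat\omega(v)=\int_{\mathbb R}\omega(x)\,e^{-2\pi i vx}\,dx$ is positive and decreasing on $[0,\frac{m}{2\sigma}]$ ("decreasing" in the weak sense). For even $M\in\mathbb N$ let $I_M=\{-\frac M2,1-\frac M2,\dots,\frac M2-1\}$. **Error constants.** For $\omega\in\Omega(m,\sigma)$ and $N\in\mathbb N$, $N\ge1$, put $\varphi(t)=\omega(\sigma N t/m)$ and $$E_{\sigma,N}(\varphi)=\sup_{v\in[-N/2,N/2]}\ \sup_{x\in[-1/2,1/2]}\Big|\sum_{r\in\mathbb Z\setminus\{0\}}\frac{\hat\varphi(v+r\sigma N)}{\hat\varphi(v)}\,e^{2\pi i r\sigma N x}\Big|,\qquad E_\sigma(\varphi)=\sup_{N\ge1}E_{\sigma,N}(\varphi),$$ where the series is summed by symmetric partial sums ($|r|\le R$, $R\to\infty$) and the window $\varphi$ varies with $N$ in the last supremum.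 **Parameters.** Let $N\ge 1$; $\sigma_1,\sigma_2>1$; integers $m_1,m_2\ge2$; let $N_1=\sigma_1N$ and $N_2=\sigma_2(N_1+2m_1)$ be even natural numbers with $2m_2\le(1-\frac1{\sigma_1})N_2$. Let $\omega_j\in\Omega(m_j,\sigma_j)$, $\varphi_j(t)=\omega_j(N_jt/m_j)$ for $j=1,2$, and $a=1+\frac{2m_1}{N_1}$. **NNFFT.** For a finite family of coefficients $f_k\in\mathbb C$ and frequency nodes $v_k\in[-\frac12,\frac12]$, and a spatial node $x\in[-\frac12,\frac12]$, the NNFFT approximates $\sum_kf_ke^{-2\pi iNv_kx}$ by the number $s_1(Nx)/\hat\varphi_1(Nx)$, where $$g_\ell=\frac1{N_1}\sum_kf_k\,\varphi_1\Big(\frac{\ell}{N_1}-v_k\Big),\quad h_s=\frac1{N_2}\sum_{\ell\in I_{N_1+2m_1}}\frac{g_\ell}{\hat\varphi_2(\ell)}\,e^{-2\pi i\ell s/N_2},\quad s_1(Nx)=\sum_{s\in I_{N_2},\ |s/N_2-x/\sigma_1|<m_2/N_2}h_s\,\varphi_2\Big(\frac x{\sigma_1}-\frac s{N_2}\Big).$$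 **Fast sinc transform.** Let $L_1,L_2$ be even natural numbers, $c_k\in\mathbb C$ and $a_k\in[-\frac12,\frac12]$ for $k\in I_{L_1}$, and $b_\ell\in[-\frac12,\frac12]$ for $\ell\in I_{L_2}$. The discrete sinc transform is $h(b_\ell)=\sum_{k\in I_{L_1}}c_k\,\mathrm{sinc}(N\pi(b_\ell-a_k))$, where $\mathrm{sinc}(y)=\frac{\sin y}{y}$ and $\mathrm{sinc}(0)=1$. For even $n$ let $z_j=\cos\frac{j\pi}n$, and let $$w_j=\frac1n\,\varepsilon_n(j)^2\sum_{i=0}^{n/2}\varepsilon_n(2i)^2\,\frac2{1-4i^2}\,\cos\frac{2ij\pi}n,\qquad j=0,\dots,n,$$ be the Clenshaw–Curtis weights, with $\varepsilon_n(0)=\varepsilon_n(n)=\frac{\sqrt2}2$ and $\varepsilon_n(j)=1$ for $0<j<n$. The fast sinc transform first computes by the NNFFT approximations $\tilde g_j$ of $\sum_kc_ke^{-\pi iNz_ja_k}$, $j=0,\dots,n$ (frequency nodes $a_k$, spatial nodes $z_j/2$), then forms $\alpha_j=w_j\tilde g_j$, and finally computes by the same NNFFT an approximation $\tilde h_\ell$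 of $\sum_{j=0}^n\alpha_je^{\pi iNz_jb_\ell}$ (frequency nodes $-z_j/2$, spatial nodes $b_\ell$). Its output is $(\tilde h_\ell)_{\ell\in I_{L_2}}$. **Theorem.** Let $\varepsilon>0$, let $n=2^t$ with an integer $t\ge2$, and write $n=\nu N$ and $C=\frac{\pi(e^2-1)}{2e}$ $(\approx3.69)$. Assume that $\nu>C$ and $$\frac{36\,(1+e^{-2CN})}{35\,(e^2-1)}\,e^{-N(\nu-C)}<\varepsilon.$$ Then $E_{\sigma_1}(\varphi_1)$ and $E_{\sigma_2}(\varphi_2)$ are finite and, with $K=E_{\sigma_1}(\varphi_1)+\dfrac{a}{\hat\varphi_1(N/2)}\,E_{\sigma_2}(\varphi_2)$, $$\max_{\ell\in I_{L_2}}|h(b_\ell)-\tilde h_\ell|\le(\varepsilon+2K+K^2)\sum_{k\in I_{L_1}}|c_k| .$$ If moreover $K\le1$, then $$\max_{\ell\in I_{L_2}}|h(b_\ell)-\tilde h_\ell|\le(\varepsilon+3K)\sum_{k\in I_{L_1}}|c_k| .$$ -/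

import Mathlib

namespace FastSinc

open scoped FourierTransform ENNReal

noncomputable section

/-- The index set `{-M/2, 1 - M/2, ..., M/2 - 1}` for an even natural number `M`. -/
def indexSet (M : ℕ) : Finset ℤ := Finset.Ico (-((M : ℤ) / 2)) ((M : ℤ) / 2)

/-- The Fourier transform `∫ φ(t) exp(-2πivt) dt` of an even real function `φ`, as a real number:
for even `φ` it is real, see `ofReal_evenFourier`. -/
def evenFourier (φ : ℝ → ℝ) (v : ℝ) : ℝ := (𝓕 (fun t : ℝ => (φ t : ℂ)) v).re

theorem ofReal_evenFourier {φ : ℝ → ℝ} (hφ : Function.Even φ) (v : ℝ) :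
    ((evenFourier φ v : ℝ) : ℂ) = 𝓕 (fun t : ℝ => (φ t : ℂ)) v := by
  rw [evenFourier, ← Complex.conj_eq_iff_re]
  rw [Real.fourier_real_eq_integral_exp_smul, ← integral_conj,
    ← MeasureTheory.integral_neg_eq_self]
  refine MeasureTheory.integral_congr_ae (Filter.Eventually.of_forall fun t => ?_)
  simp only [smul_eq_mul, map_mul, Complex.conj_ofReal, hφ t, ← Complex.exp_conj, Complex.conj_I]
  congr 2
  push_cast
  ring

/-- The set `Ω` of generators of window functions, for a truncation parameter `m` and an
oversampling factor `σ`. -/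
structure IsWindowGenerator (m : ℕ) (σ : ℝ) (ω : ℝ → ℝ) : Prop where
  mem_Icc : ∀ x, ω x ∈ Set.Icc (0 : ℝ) 1
  even : Function.Even ω
  support : tsupport ω = Set.Icc (-1) 1
  continuous : Continuous ω
  antitoneOn : AntitoneOn ω (Set.Icc 0 1)
  map_zero : ω 0 = 1
  fourier_pos : ∀ v ∈ Set.Icc (0 : ℝ) (m / (2 * σ)), 0 < evenFourier ω v
  fourier_antitoneOn : AntitoneOn (evenFourier ω) (Set.Icc 0 (m / (2 * σ)))

/-- The window function `φ(t) = ω(N' t / m)`, where `N'` is the oversampled bandwidth. -/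
def window (ω : ℝ → ℝ) (m : ℕ) (N' : ℝ) (t : ℝ) : ℝ := ω (N' * t / m)

/-- The function `x ↦ ∑_{r ≠ 0} φ̂(v + r N') / φ̂(v) · exp(2πi r N' x)`. The series is a Fourier
series: it is summed by symmetric partial sums, and need not converge absolutely. -/
def aliasingSeries (φ : ℝ → ℝ) (N' v x : ℝ) : ℂ :=
  ∑'[SummationFilter.symmetricIcc ℤ] r : ℤ, if r = 0 then 0 else
    ((evenFourier φ (v + r * N') / evenFourier φ v : ℝ) : ℂ) *
      Complex.exp (2 * Real.pi * Complex.I * r * N' * x)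

/-- The constant `E_{σ,N}(φ)`, where `φ(t) = ω(σ N t / m)`: the largest sup norm over one period
`x ∈ [-1/2, 1/2]` of the aliasing series, for `v ∈ [-N/2, N/2]`. -/
def errorConstantAt (ω : ℝ → ℝ) (m : ℕ) (σ : ℝ) (N : ℕ) : ℝ≥0∞ :=
  ⨆ v ∈ Set.Icc (-(N : ℝ) / 2) (N / 2), ⨆ x ∈ Set.Icc (-1 / 2 : ℝ) (1 / 2),
    ‖aliasingSeries (window ω m (σ * N)) (σ * N) v x‖ₑ

/-- The general `C(𝕋)`-error constant `E_σ(φ) = sup_N E_{σ,N}(φ)`. Here the window function `φ`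
varies with `N`. -/
def errorConstant (ω : ℝ → ℝ) (m : ℕ) (σ : ℝ) : ℝ≥0∞ :=
  ⨆ N : ℕ, ⨆ _ : 1 ≤ N, errorConstantAt ω m σ N

section NNFFT

variable {ι : Type*}

/-- Step 1: the sums `g_ℓ = 1/N₁ ∑_k f_k φ₁(ℓ/N₁ - v_k)`. -/
def nnfftG (φ₁ : ℝ → ℝ) (N₁ : ℕ) (S : Finset ι) (f : ι → ℂ) (v : ι → ℝ) (l : ℤ) : ℂ :=
  1 / (N₁ : ℂ) * ∑ k ∈ S, f k * (φ₁ ((l : ℝ) / N₁ - v k) : ℂ)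

/-- Steps 2 and 3: `h_s = 1/N₂ ∑_ℓ g_ℓ / φ̂₂(ℓ) · exp(-2πiℓs/N₂)`. -/
def nnfftH (φ₁ φ₂ : ℝ → ℝ) (m₁ N₁ N₂ : ℕ) (S : Finset ι) (f : ι → ℂ) (v : ι → ℝ) (s : ℤ) : ℂ :=
  1 / (N₂ : ℂ) * ∑ l ∈ indexSet (N₁ + 2 * m₁),
    nnfftG φ₁ N₁ S f v l / (evenFourier φ₂ l : ℂ) *
      Complex.exp (-2 * Real.pi * Complex.I * l * s / N₂)

/-- Step 4: the short sums `s₁(Nx) = ∑_s h_s φ₂(x/σ₁ - s/N₂)`, over the `s` with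
`|s/N₂ - x/σ₁| < m₂/N₂`. -/
def nnfftS (φ₁ φ₂ : ℝ → ℝ) (m₁ m₂ N₁ N₂ : ℕ) (σ₁ : ℝ) (S : Finset ι) (f : ι → ℂ) (v : ι → ℝ)
    (x : ℝ) : ℂ :=
  ∑ s ∈ indexSet N₂ with |((s : ℤ) : ℝ) / N₂ - x / σ₁| < (m₂ : ℝ) / N₂,
    nnfftH φ₁ φ₂ m₁ N₁ N₂ S f v s * (φ₂ (x / σ₁ - (s : ℝ) / N₂) : ℂ)

/-- The output `s₁(Nx) / φ̂₁(Nx)` of the NNFFT at the spatial node `x`, for coefficients `f_k` and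
frequency nodes `v_k`, `k ∈ S`, and for the window functions `φ₁(t) = ω₁(N₁t/m₁)`,
`φ₂(t) = ω₂(N₂t/m₂)`. It approximates `∑_{k ∈ S} f_k exp(-2πi N v_k x)`. -/
def nnfft (ω₁ ω₂ : ℝ → ℝ) (m₁ m₂ N N₁ N₂ : ℕ) (σ₁ : ℝ) (S : Finset ι) (f : ι → ℂ) (v : ι → ℝ)
    (x : ℝ) : ℂ :=
  nnfftS (window ω₁ m₁ N₁) (window ω₂ m₂ N₂) m₁ m₂ N₁ N₂ σ₁ S f v x /
    (evenFourier (window ω₁ m₁ N₁) (N * x) : ℂ)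

end NNFFT

/-- The Chebyshev points `z_j = cos(jπ/n)`. -/
def chebyshevPoint (n j : ℕ) : ℝ := Real.cos (j * Real.pi / n)

/-- `ε_n(0) = ε_n(n) = √2/2`, and `ε_n(j) = 1` for `0 < j < n`. -/
def ccEps (n j : ℕ) : ℝ := if j = 0 ∨ j = n then Real.sqrt 2 / 2 else 1

/-- The Clenshaw--Curtis weights, normalised to have sum `1`. -/
def ccWeight (n k : ℕ) : ℝ :=
  1 / (n : ℝ) * ccEps n k ^ 2 * ∑ j ∈ Finset.range (n / 2 + 1),
    ccEps n (2 * j) ^ 2 * (2 / (1 - 4 * (j : ℝ) ^ 2)) * Real.cos (2 * j * k * Real.pi / n)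

/-- The constant `C = π(e² - 1)/(2e) ≈ 3.69`. -/
def ccConst : ℝ := Real.pi * (Real.exp 1 ^ 2 - 1) / (2 * Real.exp 1)

/-- The discrete sinc transform `h(b) = ∑_{k ∈ I_{L₁}} c_k sinc(Nπ(b - a_k))`. -/
def sincTransform (N L₁ : ℕ) (c : ℤ → ℂ) (a : ℤ → ℝ) (b : ℝ) : ℂ :=
  ∑ k ∈ indexSet L₁, c k * (Real.sinc (N * Real.pi * (b - a k)) : ℂ)

/-- The output at the node `b` of the fast sinc transform.
Step 1: the NNFFT approximates `g_j = ∑_k c_k exp(-πi N z_j a_k)` by `g̃_j`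
(frequency nodes `a_k`, spatial nodes `z_j / 2`).
Step 2: `α_j = w_j g̃_j`.
Step 3: the NNFFT approximates `∑_{j=0}^n α_j exp(πi N z_j b)`
(frequency nodes `-z_j / 2`, spatial node `b`). -/
def fastSincTransform (ω₁ ω₂ : ℝ → ℝ) (m₁ m₂ N N₁ N₂ : ℕ) (σ₁ : ℝ) (n L₁ : ℕ)
    (c : ℤ → ℂ) (a : ℤ → ℝ) (b : ℝ) : ℂ :=
  nnfft ω₁ ω₂ m₁ m₂ N N₁ N₂ σ₁ (Finset.range (n + 1))
    (fun j => (ccWeight n j : ℂ) *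
      nnfft ω₁ ω₂ m₁ m₂ N N₁ N₂ σ₁ (indexSet L₁) c a (chebyshevPoint n j / 2))
    (fun j => -chebyshevPoint n j / 2) b

/-- The factor `K = E_{σ₁}(φ₁) + a E_{σ₂}(φ₂) / φ̂₁(N/2)` with `a = 1 + 2m₁/N₁`. -/
def errorFactor (ω₁ ω₂ : ℝ → ℝ) (m₁ m₂ N N₁ : ℕ) (σ₁ σ₂ : ℝ) : ℝ :=
  (errorConstant ω₁ m₁ σ₁).toReal +
    (1 + 2 * (m₁ : ℝ) / N₁) / evenFourier (window ω₁ m₁ N₁) ((N : ℝ) / 2) *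
      (errorConstant ω₂ m₂ σ₂).toReal

end

end FastSinc

/-! The error comes from three sources: the two window functions of the NNFFT, and the quadrature
that replaces the sinc kernel by a sum of exponentials.

Windows. Poisson summation turns the aliasing series, with the term for `r = 0` restored, into a
finite sum of translates of the window. Hence each sampled window sum equals the wanted exponential
times `1 +` an aliasing series, and the relative error is at most `E`. Poisson summation must hold
pointwise although `ω` is only continuous and piecewise monotone: its transform is `O(1/ξ)`, so the
series need not converge absolutely. Fejér's theorem gives Cesàro convergence, and Hardy's Tauberian
theorem upgrades it to convergence of the symmetric partial sums (`hasSum_evenFourier`). The finite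
side has at most `2m + 1` terms of size at most `1/m`, which bounds `E` uniformly in `N`. Applying
the identity to both windows gives the NNFFT error `K ∑ |f_k|` (`norm_nnfft_sub_le`).

Quadrature. One has `2 sinc β = ∫ cos(β cos θ) sin θ dθ` over `[0, π]`. The Fourier coefficients of
`cos(β cos θ)` in `cos(2sθ)` are bounded by `cosh(|β| sinh 1) exp(-2|s|)`, by a contour shift.
Clenshaw–Curtis quadrature is exact for `|s| ≤ n/2` and errs by at most `36/35` beyond. Summing the
geometric tail gives the bound on `ε`, with `C = π sinh 1`.

Assembly. The weights are nonnegative with sum `1`, so they do not amplify errors. Quadrature costs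
`ε`, the first NNFFT costs `K`, and the second costs `K(1 + K)`, because its input has norm at most
`1 + K`, all relative to `∑ |c_k|`. -/

namespace FastSinc

open scoped FourierTransform ENNReal

open Filter Topology MeasureTheory AddCircle

noncomputable section

/-! ### Pointwise convergence of Fourier series -/

/-- Hardy's Tauberian theorem: a sequence with increments `O(1/n)` that converges in the sense
of Cesàro converges. -/
theorem tendsto_of_tendsto_cesaro {E : Type*} [NormedAddCommGroup E] [NormedSpace ℝ E]
    {S : ℕ → E} {l : E} {C : ℝ} (hC : 0 ≤ C) (hS : ∀ n, ‖S (n + 1) - S n‖ ≤ C / (n + 1))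
    (h : Tendsto (fun n : ℕ => (n : ℝ)⁻¹ • ∑ j ∈ Finset.range n, S j) atTop (𝓝 l)) :
    Tendsto S atTop (𝓝 l) := by
  have hdiff : ∀ n j : ℕ, ‖S (n + j) - S n‖ ≤ C * j / (n + 1) := by
    intro n j
    induction j with
    | zero => simp
    | succ j ih =>
      have h1 := hS (n + j)
      have h2 : C / ((n + j : ℕ) + 1 : ℝ) ≤ C / (n + 1) := by
        apply div_le_div_of_nonneg_left hC (by positivity)
        push_cast
        linarith [(Nat.cast_nonneg j : (0 : ℝ) ≤ j)]
      have h3 : S (n + (j + 1)) - S n = (S (n + j + 1) - S (n + j)) + (S (n + j) - S n) := by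
        rw [← add_assoc]; abel
      rw [h3]
      refine (norm_add_le _ _).trans ((add_le_add (h1.trans h2) ih).trans (le_of_eq ?_))
      push_cast
      ring
  have hT : ∀ δ > 0, ∀ᶠ n : ℕ in atTop, ‖∑ j ∈ Finset.range n, (S j - l)‖ ≤ δ * n := by
    intro δ hδ
    filter_upwards [(Metric.tendsto_nhds.1 h) δ hδ, eventually_gt_atTop 0] with n hn hn0
    have hn' : (0 : ℝ) < n := by exact_mod_cast hn0
    have : ∑ j ∈ Finset.range n, (S j - l) =
        (n : ℝ) • ((n : ℝ)⁻¹ • ∑ j ∈ Finset.range n, S j - l) := by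
      rw [smul_sub, smul_inv_smul₀ hn'.ne', Finset.sum_sub_distrib]
      simp [Nat.cast_smul_eq_nsmul]
    rw [this, norm_smul, Real.norm_of_nonneg hn'.le, mul_comm]
    rw [dist_eq_norm] at hn
    gcongr
  rw [Metric.tendsto_nhds]
  intro ε hε
  -- `S n` is compared with its average over the block from `n` to `n + k`, where `k ≈ lam * n`.
  -- Oscillation inside the block costs at most `2 * C * lam ≤ ε/2`; the two Cesàro sums cost `δ *
  -- (2/lam + 1) = ε/4`.
  set lam : ℝ := ε / (4 * (C + 1)) with hlam
  have hlam0 : 0 < lam := by positivity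
  set δ : ℝ := ε / (4 * (2 / lam + 1)) with hδ
  have hδ0 : 0 < δ := by positivity
  obtain ⟨n₀, hn₀⟩ := eventually_atTop.1 (hT δ hδ0)
  filter_upwards [eventually_ge_atTop n₀, eventually_gt_atTop 0,
    eventually_ge_atTop ⌈1 / lam⌉₊] with n hn hn0 hn1
  have hn' : (0 : ℝ) < n := by exact_mod_cast hn0
  set k : ℕ := ⌈lam * n⌉₊ with hk
  have hk1 : lam * n ≤ k := Nat.le_ceil _
  have hk2 : (k : ℝ) < lam * n + 1 := Nat.ceil_lt_add_one (by positivity)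
  have hk0 : (0 : ℝ) < k := lt_of_lt_of_le (by positivity) hk1
  have h1 : 1 ≤ lam * n := by
    have : 1 / lam ≤ n := (Nat.le_ceil _).trans (by exact_mod_cast hn1)
    rw [div_le_iff₀ hlam0] at this
    linarith
  have key : (k : ℝ) • (S n - l) = ∑ j ∈ Finset.range (n + k), (S j - l) -
      ∑ j ∈ Finset.range n, (S j - l) - ∑ j ∈ Finset.range k, (S (n + j) - S n) := by
    rw [Finset.sum_range_add, add_sub_cancel_left, ← Finset.sum_sub_distrib]
    simp [Nat.cast_smul_eq_nsmul, smul_sub]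
  have b1 := hn₀ (n + k) (by omega)
  have b2 := hn₀ n hn
  have b3 : ‖∑ j ∈ Finset.range k, (S (n + j) - S n)‖ ≤ k * (C * k / n) := by
    refine (norm_sum_le _ _).trans ((Finset.sum_le_card_nsmul _ _ (C * k / n) ?_).trans ?_)
    · intro j hj
      refine (hdiff n j).trans ?_
      have : (j : ℝ) ≤ k := by exact_mod_cast (Finset.mem_range.1 hj).le
      gcongr
      linarith
    · simp
  have b4 : k * ‖S n - l‖ ≤ δ * (n + k : ℕ) + δ * n + k * (C * k / n) := by
    have : (k : ℝ) * ‖S n - l‖ = ‖(k : ℝ) • (S n - l)‖ := by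
      rw [norm_smul, Real.norm_of_nonneg hk0.le]
    rw [this, key]
    exact (norm_sub_le _ _).trans (add_le_add ((norm_sub_le _ _).trans (add_le_add b1 b2)) b3)
  have b5 : ‖S n - l‖ ≤ δ * (2 / lam + 1) + C * (2 * lam) := by
    have e1 : C * k / n ≤ C * (2 * lam) := by
      rw [mul_div_assoc]
      gcongr
      rw [div_le_iff₀ hn']
      linarith
    have e2 : (n : ℝ) ≤ k / lam := by
      rw [le_div_iff₀ hlam0]; linarith
    have e3 : δ * (n + k : ℕ) + δ * n ≤ k * (δ * (2 / lam + 1)) := by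
      push_cast
      have : k * (δ * (2 / lam + 1)) = δ * (2 * (k / lam) + k) := by ring
      rw [this, ← mul_add]
      exact mul_le_mul_of_nonneg_left (by linarith) hδ0.le
    have e4 : k * ‖S n - l‖ ≤ k * (δ * (2 / lam + 1) + C * (2 * lam)) := by
      rw [mul_add]
      refine b4.trans (add_le_add e3 ?_)
      gcongr
    exact le_of_mul_le_mul_left e4 hk0
  have e5 : δ * (2 / lam + 1) = ε / 4 := by
    rw [hδ]; field_simp
  have e6 : C * (2 * lam) ≤ ε / 2 := by
    have : (C + 1) * (2 * lam) = ε / 2 := by rw [hlam]; field_simp; ring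
    nlinarith
  rw [dist_eq_norm]
  linarith

/-- The symmetric partial sum of a bilateral sequence. -/
def symmSum (u : ℤ → ℂ) (n : ℕ) : ℂ := ∑ r ∈ Finset.Icc (-(n : ℤ)) n, u r

theorem symmSum_succ (u : ℤ → ℂ) (n : ℕ) :
    symmSum u (n + 1) = symmSum u n + u (n + 1) + u (-(n + 1)) := by
  have h : Finset.Icc (-((n + 1 : ℕ) : ℤ)) ((n + 1 : ℕ) : ℤ) =
      insert (-((n : ℤ) + 1)) (insert ((n : ℤ) + 1) (Finset.Icc (-(n : ℤ)) n)) := by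
    ext x
    simp only [Finset.mem_Icc, Finset.mem_insert]
    omega
  rw [symmSum, h, Finset.sum_insert, Finset.sum_insert, symmSum]
  · ring
  · simp
  · simp only [Finset.mem_Icc, Finset.mem_insert]
    omega

/-- These are the entries by which an `(n+1) × (n+1)` Toeplitz matrix exceeds its `n × n` corner:
last row, then last column without the diagonal entry. -/
theorem sum_range_sub_add_sum_range_sub (u : ℤ → ℂ) (n : ℕ) :
    ∑ j ∈ Finset.range (n + 1), u (n - j) + ∑ j ∈ Finset.range n, u (j - n) = symmSum u n := by
  induction n with
  | zero => simp [symmSum]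
  | succ n ih =>
    rw [symmSum_succ, ← ih,
      Finset.sum_range_succ' (fun j : ℕ => u (((n + 1 : ℕ) : ℤ) - j)),
      Finset.sum_range_succ' (fun j : ℕ => u ((j : ℤ) - (n + 1 : ℕ)))]
    have h1 : ∀ j : ℕ, u (((n + 1 : ℕ) : ℤ) - ((j + 1 : ℕ) : ℤ)) = u (n - j) := fun j => by
      congr 1; push_cast; ring
    have h2 : ∀ j : ℕ, u (((j + 1 : ℕ) : ℤ) - ((n + 1 : ℕ) : ℤ)) = u (j - n) := fun j => by
      congr 1; push_cast; ring
    simp only [h1, h2]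
    push_cast
    rw [sub_zero, zero_sub]
    ring

/-- The Cesàro sum as a Toeplitz form. -/
theorem sum_symmSum (u : ℤ → ℂ) (n : ℕ) :
    ∑ j ∈ Finset.range n, symmSum u j =
      ∑ j ∈ Finset.range n, ∑ k ∈ Finset.range n, u ((j : ℤ) - k) := by
  induction n with
  | zero => simp
  | succ n ih =>
    rw [Finset.sum_range_succ, ih, Finset.sum_range_succ _ n,
      ← sum_range_sub_add_sum_range_sub u n]
    simp only [Finset.sum_range_succ _ n, Finset.sum_add_distrib]
    ring

section FourierSeries

variable (f : C(UnitAddCircle, ℂ))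

/-- The Fejér kernel appears as the squared modulus of a geometric sum, so that its positivity is
evident and no closed form is needed. -/
theorem toeplitz_fourierCoeff (n : ℕ) (x : UnitAddCircle) :
    ∑ j ∈ Finset.range n, ∑ k ∈ Finset.range n,
      fourierCoeff f ((j : ℤ) - k) * fourier ((j : ℤ) - k) x =
    ∫ t, (‖∑ j ∈ Finset.range n, (fourier (j : ℤ) (x - t) : ℂ)‖ ^ 2 : ℝ) * f t
      ∂haarAddCircle := by
  have hexp : ∀ (r : ℤ) (t : UnitAddCircle),
      (fourier (-r) t : ℂ) * fourier r x = fourier r (x - t) := by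
    intro r t
    simp only [fourier_apply, ← Circle.coe_mul, ← toCircle_add]
    congr 2
    rw [smul_sub, neg_smul]; abel
  have hsq : ∀ t : UnitAddCircle,
      ((‖∑ j ∈ Finset.range n, (fourier (j : ℤ) (x - t) : ℂ)‖ ^ 2 : ℝ) : ℂ) =
        ∑ j ∈ Finset.range n, ∑ k ∈ Finset.range n, fourier ((j : ℤ) - k) (x - t) := by
    intro t
    rw [Complex.ofReal_pow, ← Complex.mul_conj', map_sum, Finset.sum_mul_sum]
    refine Finset.sum_congr rfl fun j _ => Finset.sum_congr rfl fun k _ => ?_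
    rw [← fourier_neg, ← fourier_add, sub_eq_add_neg (j : ℤ) (k : ℤ)]
  simp_rw [hsq, Finset.sum_mul]
  have hint : ∀ r : ℤ, Integrable (fun t => fourier r (x - t) * f t) haarAddCircle := by
    intro r
    apply Continuous.integrable_of_hasCompactSupport
    · exact ((map_continuous (fourier r)).comp (continuous_const.sub continuous_id)).mul
        (map_continuous f)
    · exact HasCompactSupport.of_compactSpace _
  rw [integral_finsetSum _ fun j _ => integrable_finsetSum _ fun k _ => hint _]
  refine Finset.sum_congr rfl fun j _ => ?_
  rw [integral_finsetSum _ fun k _ => hint _]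
  refine Finset.sum_congr rfl fun k _ => ?_
  rw [fourierCoeff, ← integral_mul_const]
  refine integral_congr_ae (Eventually.of_forall fun t => ?_)
  simp only [smul_eq_mul]
  rw [← hexp]; ring

/-- Take `f = 1` in the Toeplitz identity: only the `n` diagonal entries survive. -/
theorem integral_norm_sq_sum_fourier (n : ℕ) (x : UnitAddCircle) :
    ∫ t, ‖∑ j ∈ Finset.range n, (fourier (j : ℤ) (x - t) : ℂ)‖ ^ 2 ∂haarAddCircle = n := by
  have h := toeplitz_fourierCoeff (fourier 0) n x
  simp only [fourierCoeff_fourier, fourier_zero, mul_one] at h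
  rw [integral_complex_ofReal] at h
  have h2 : ∑ j ∈ Finset.range n, ∑ k ∈ Finset.range n,
      (Pi.single (0 : ℤ) (1 : ℂ) : ℤ → ℂ) ((j : ℤ) - k) * fourier ((j : ℤ) - k) x = n := by
    have : ∀ j ∈ Finset.range n, ∑ k ∈ Finset.range n,
      (Pi.single (0 : ℤ) (1 : ℂ) : ℤ → ℂ) ((j : ℤ) - k) * fourier ((j : ℤ) - k) x = 1 := by
      intro j hj
      rw [Finset.sum_eq_single j]
      · simp
      · intro k _ hk
        rw [Pi.single_eq_of_ne, zero_mul]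
        omega
      · exact fun hh => absurd hj hh
    rw [Finset.sum_congr rfl this]
    simp
  rw [h2] at h
  exact_mod_cast h.symm

theorem norm_toeplitz_fourierCoeff_le (n : ℕ) (x : UnitAddCircle) :
    ‖∑ j ∈ Finset.range n, ∑ k ∈ Finset.range n,
      fourierCoeff f ((j : ℤ) - k) * fourier ((j : ℤ) - k) x‖ ≤ n * ‖f‖ := by
  rw [toeplitz_fourierCoeff]
  have hcont : Continuous fun t : UnitAddCircle =>
      ‖∑ j ∈ Finset.range n, (fourier (j : ℤ) (x - t) : ℂ)‖ ^ 2 := by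
    refine Continuous.pow (Continuous.norm ?_) 2
    exact continuous_finsetSum _ fun j _ =>
      (map_continuous (fourier (j : ℤ))).comp (continuous_const.sub continuous_id)
  refine (norm_integral_le_of_norm_le (g := fun t =>
    ‖∑ j ∈ Finset.range n, (fourier (j : ℤ) (x - t) : ℂ)‖ ^ 2 * ‖f‖) ?_ ?_).trans ?_
  · exact (hcont.mul continuous_const).integrable_of_hasCompactSupport
      (HasCompactSupport.of_compactSpace _)
  · refine Eventually.of_forall fun t => ?_
    rw [norm_mul, Complex.norm_real, Real.norm_of_nonneg (by positivity)]
    gcongr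
    exact f.norm_coe_le_norm t
  · rw [integral_mul_const, integral_norm_sq_sum_fourier]

/-- The symmetric partial sums of the Fourier series of `f` at `x`. -/
def fourierPartialSum (x : UnitAddCircle) (n : ℕ) : ℂ :=
  symmSum (fun r => fourierCoeff f r * fourier r x) n

theorem norm_sum_fourierPartialSum_le (n : ℕ) (x : UnitAddCircle) :
    ‖∑ j ∈ Finset.range n, fourierPartialSum f x j‖ ≤ n * ‖f‖ := by
  simp only [fourierPartialSum, sum_symmSum]
  exact norm_toeplitz_fourierCoeff_le f n x

theorem integrable_coe_circle : Integrable (fun t => f t) haarAddCircle :=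
  (map_continuous f).integrable_of_hasCompactSupport (HasCompactSupport.of_compactSpace _)

theorem fourierPartialSum_sub (g : C(UnitAddCircle, ℂ)) (x : UnitAddCircle) (n : ℕ) :
    fourierPartialSum (f - g) x n = fourierPartialSum f x n - fourierPartialSum g x n := by
  simp only [fourierPartialSum, symmSum]
  rw [← Finset.sum_sub_distrib]
  refine Finset.sum_congr rfl fun r _ => ?_
  rw [← sub_mul]
  congr 1
  simp only [fourierCoeff]
  rw [← integral_sub ((integrable_coe_circle f).fourier_smul _)
    ((integrable_coe_circle g).fourier_smul _)]
  simp only [ContinuousMap.sub_apply, smul_sub]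

theorem tendsto_fourierPartialSum_of_mem_span {g : C(UnitAddCircle, ℂ)}
    (hg : g ∈ Submodule.span ℂ (Set.range (@fourier 1))) (x : UnitAddCircle) :
    Tendsto (fourierPartialSum g x) atTop (𝓝 (g x)) := by
  induction hg using Submodule.span_induction with
  | mem g hg =>
    obtain ⟨r, rfl⟩ := hg
    refine tendsto_const_nhds.congr' ?_
    filter_upwards [eventually_ge_atTop r.natAbs] with n hn
    rw [fourierPartialSum, symmSum, Finset.sum_eq_single r]
    · rw [fourierCoeff_fourier]; simp
    · intro k _ hk
      rw [fourierCoeff_fourier, Pi.single_eq_of_ne hk, zero_mul]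
    · intro h
      exact absurd (Finset.mem_Icc.2 (by omega)) h
  | zero =>
    refine tendsto_const_nhds.congr fun n => ?_
    simp [fourierPartialSum, symmSum, fourierCoeff]
  | add f g _ _ hf hg =>
    refine (hf.add hg).congr fun n => ?_
    have h1 := fourierPartialSum_sub (f + g) g x n
    rw [add_sub_cancel_right] at h1
    rw [h1]; ring
  | smul c g _ hg =>
    refine (hg.const_mul c).congr fun n => ?_
    simp only [fourierPartialSum, symmSum, Finset.mul_sum]
    refine Finset.sum_congr rfl fun r _ => ?_
    have := fourierCoeff.const_mul (fun t => g t) c r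
    simp only [ContinuousMap.coe_smul, Pi.smul_def, smul_eq_mul]
    rw [this]; ring

/-- **Fejér's theorem**. -/
theorem tendsto_cesaro_fourierPartialSum (x : UnitAddCircle) :
    Tendsto (fun n : ℕ => (n : ℝ)⁻¹ • ∑ j ∈ Finset.range n, fourierPartialSum f x j) atTop
      (𝓝 (f x)) := by
  rw [Metric.tendsto_nhds]
  intro ε hε
  -- Trigonometric polynomials are dense, and the Cesàro means are contractions in the sup norm, so
  -- convergence passes from polynomials to `f`.
  have hf : f ∈ closure (Submodule.span ℂ (Set.range (@fourier 1)) : Set C(UnitAddCircle, ℂ)) := by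
    rw [← Submodule.topologicalClosure_coe, span_fourier_closure_eq_top]
    trivial
  obtain ⟨g, hg, hfg⟩ := Metric.mem_closure_iff.1 hf (ε / 4) (by positivity)
  have h := (tendsto_fourierPartialSum_of_mem_span hg x).cesaro_smul
  filter_upwards [(Metric.tendsto_nhds.1 h) (ε / 4) (by positivity), eventually_gt_atTop 0]
    with n hn hn0
  have hn' : (0 : ℝ) < n := by exact_mod_cast hn0
  rw [dist_eq_norm] at hn hfg ⊢
  have h1 : ‖(n : ℝ)⁻¹ • ∑ j ∈ Finset.range n, fourierPartialSum (f - g) x j‖ ≤ ε / 4 := by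
    rw [norm_smul, norm_inv, Real.norm_of_nonneg hn'.le, inv_mul_le_iff₀ hn']
    refine (norm_sum_fourierPartialSum_le (f - g) n x).trans ?_
    gcongr
  have h2 : ‖(f - g) x‖ ≤ ε / 4 := ((f - g).norm_coe_le_norm x).trans hfg.le
  have h3 : (n : ℝ)⁻¹ • ∑ j ∈ Finset.range n, fourierPartialSum f x j - f x =
      (n : ℝ)⁻¹ • ∑ j ∈ Finset.range n, fourierPartialSum (f - g) x j +
      ((n : ℝ)⁻¹ • ∑ j ∈ Finset.range n, fourierPartialSum g x j - g x) - (f - g) x := by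
    simp only [fourierPartialSum_sub, Finset.sum_sub_distrib, smul_sub, ContinuousMap.sub_apply]
    ring
  rw [h3]
  have := (norm_sub_le _ _).trans (add_le_add (norm_add_le
    ((n : ℝ)⁻¹ • ∑ j ∈ Finset.range n, fourierPartialSum (f - g) x j)
    ((n : ℝ)⁻¹ • ∑ j ∈ Finset.range n, fourierPartialSum g x j - g x)) (le_refl ‖(f - g) x‖))
  linarith

/-- A continuous function with Fourier coefficients `O(1/r)` is the pointwise sum of its Fourier
series. -/
theorem tendsto_fourierPartialSum {C : ℝ}
    (hC : ∀ r : ℤ, r ≠ 0 → ‖fourierCoeff f r‖ ≤ C / |(r : ℝ)|) (x : UnitAddCircle) :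
    Tendsto (fourierPartialSum f x) atTop (𝓝 (f x)) := by
  have hC0 : 0 ≤ C := by simpa using (norm_nonneg _).trans (hC 1 one_ne_zero)
  refine tendsto_of_tendsto_cesaro (C := 2 * C) (by positivity) (fun n => ?_)
    (tendsto_cesaro_fourierPartialSum f x)
  have hb : ∀ r : ℤ, |(r : ℝ)| = n + 1 → ‖fourierCoeff f r * fourier r x‖ ≤ C / (n + 1) := by
    intro r hr
    have hr0 : r ≠ 0 := by
      rintro rfl
      simp only [Int.cast_zero, abs_zero] at hr
      linarith [(Nat.cast_nonneg n : (0 : ℝ) ≤ n)]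
    rw [norm_mul, fourier_apply, Circle.norm_coe, mul_one, ← hr]
    exact hC r hr0
  rw [fourierPartialSum, fourierPartialSum, symmSum_succ, add_assoc, add_sub_cancel_left]
  refine (norm_add_le _ _).trans ((add_le_add (hb _ ?_) (hb _ ?_)).trans (le_of_eq (by ring)))
  · push_cast
    rw [abs_of_nonneg (by positivity)]
  · push_cast
    rw [abs_neg, abs_of_nonneg (by positivity)]

end FourierSeries

/-! ### Decay of the Fourier transform of a window -/

namespace IsWindowGenerator

variable {m : ℕ} {σ : ℝ} {ω : ℝ → ℝ}

theorem nonneg (h : IsWindowGenerator m σ ω) (x : ℝ) : 0 ≤ ω x := (h.mem_Icc x).1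

theorem le_one (h : IsWindowGenerator m σ ω) (x : ℝ) : ω x ≤ 1 := (h.mem_Icc x).2

theorem eq_zero_of_one_le (h : IsWindowGenerator m σ ω) {x : ℝ} (hx : 1 ≤ x) : ω x = 0 := by
  have hcl : IsClosed {x | ω x = 0} := isClosed_eq h.continuous continuous_const
  have hsub : Set.Ioi (1 : ℝ) ⊆ {x | ω x = 0} := fun y hy =>
    image_eq_zero_of_notMem_tsupport (by rw [h.support]; exact fun hh => not_lt.2 hh.2 hy)
  have := hcl.closure_subset_iff.2 hsub
  rw [closure_Ioi] at this
  exact this hx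

theorem eq_zero_of_one_le_abs (h : IsWindowGenerator m σ ω) {x : ℝ} (hx : 1 ≤ |x|) : ω x = 0 := by
  rcases abs_cases x with ⟨h1, _⟩ | ⟨h1, _⟩
  · exact h.eq_zero_of_one_le (h1 ▸ hx)
  · rw [← h.even]
    exact h.eq_zero_of_one_le (h1 ▸ hx)

theorem hasCompactSupport (h : IsWindowGenerator m σ ω) : HasCompactSupport ω := by
  rw [HasCompactSupport, h.support]
  exact isCompact_Icc

theorem antitoneOn_Ici (h : IsWindowGenerator m σ ω) : AntitoneOn ω (Set.Ici 0) := by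
  intro x hx y hy hxy
  rcases le_total 1 y with h1 | h1
  · rw [h.eq_zero_of_one_le h1]
    exact h.nonneg x
  · exact h.antitoneOn ⟨hx, hxy.trans h1⟩ ⟨hy, h1⟩ hxy

theorem antitone_max (h : IsWindowGenerator m σ ω) : Antitone fun x => ω (max x 0) :=
  fun x y hxy => h.antitoneOn_Ici (le_max_right x 0) (le_max_right y 0) (max_le_max_right 0 hxy)

/-- This writes `ω` as the difference of the decreasing functions `ω (max x 0)` and `1 - ω (max (-x)
0)`, both with values in `[0, 1]`. -/
theorem eq_add_sub_one (h : IsWindowGenerator m σ ω) (x : ℝ) :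
    ω x = ω (max x 0) + ω (max (-x) 0) - 1 := by
  rcases le_total 0 x with hx | hx
  · rw [max_eq_left hx, max_eq_right (by linarith), h.map_zero]; ring
  · rw [max_eq_right hx, max_eq_left (by linarith), h.map_zero, h.even]; ring

end IsWindowGenerator

/-- After the translation only two end intervals of length `h` remain; the left one contributes at
most `h` and the right one enters with a negative sign. -/
theorem integral_sub_comp_add_le {p : ℝ → ℝ} (hp : Continuous p) (hp01 : ∀ x, p x ∈ Set.Icc (0 : ℝ) 1)
    (a b : ℝ) {h : ℝ} (hh : 0 ≤ h) : ∫ x in a..b, (p x - p (x + h)) ≤ h := by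
  have hi : ∀ a b, IntervalIntegrable p volume a b := fun a b => hp.intervalIntegrable a b
  rw [intervalIntegral.integral_sub (hi _ _)
    ((by fun_prop : Continuous fun x => p (x + h)).intervalIntegrable _ _),
    intervalIntegral.integral_comp_add_right,
    intervalIntegral.integral_interval_sub_interval_comm (hi _ _) (hi _ _) (hi _ _)]
  have h1 : ∫ x in a..a + h, p x ≤ ∫ x in a..a + h, (1 : ℝ) :=
    intervalIntegral.integral_mono_on (by linarith) (hi _ _) (by simp) fun x _ => (hp01 x).2
  have h2 : 0 ≤ ∫ x in b..b + h, p x :=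
    intervalIntegral.integral_nonneg (by linarith) fun x _ => (hp01 x).1
  simp at h1
  linarith

namespace IsWindowGenerator

variable {m : ℕ} {σ : ℝ} {ω : ℝ → ℝ}

/-- Bounded variation in integrated form: each of the two monotone parts of `ω` contributes at most
`h`. -/
theorem integral_abs_sub_le (hω : IsWindowGenerator m σ ω) {h : ℝ} (hh : 0 ≤ h) :
    ∫ x, |ω x - ω (x + h)| ≤ 2 * h := by
  have hsupp : Function.support (fun x => |ω x - ω (x + h)|) ⊆ Set.Ioc (-1 - h) 1 := by
    intro x hx
    by_contra hx'
    apply hx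
    rw [Set.mem_Ioc, not_and_or, not_lt, not_le] at hx'
    have h1 : 1 ≤ |x| ∧ 1 ≤ |x + h| := by
      rcases hx' with hx' | hx'
      · constructor <;> rw [le_abs] <;> right <;> linarith
      · constructor <;> rw [le_abs] <;> left <;> linarith
    simp only [hω.eq_zero_of_one_le_abs h1.1, hω.eq_zero_of_one_le_abs h1.2, sub_self, abs_zero]
  rw [← intervalIntegral.integral_eq_integral_of_support_subset hsupp]
  have hp : Continuous fun x => ω (max x 0) := hω.continuous.comp (continuous_id.max continuous_const)
  have hq : Continuous fun x => 1 - ω (max (-x) 0) :=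
    continuous_const.sub (hω.continuous.comp (continuous_neg.max continuous_const))
  have hω1 := hω.continuous
  have hab : -1 - h ≤ 1 := by linarith
  have hle : ∫ x in (-1 - h)..1, |ω x - ω (x + h)| ≤
      ∫ x in (-1 - h)..1, ((ω (max x 0) - ω (max (x + h) 0)) +
        ((1 - ω (max (-x) 0)) - (1 - ω (max (-(x + h)) 0)))) := by
    refine intervalIntegral.integral_mono_on hab ?_ ?_ fun x _ => ?_
    · exact (by fun_prop : Continuous fun x => |ω x - ω (x + h)|).intervalIntegrable _ _
    · exact (by fun_prop : Continuous fun x => (ω (max x 0) - ω (max (x + h) 0)) +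
        ((1 - ω (max (-x) 0)) - (1 - ω (max (-(x + h)) 0)))).intervalIntegrable _ _
    · have h1 : ω (max (x + h) 0) ≤ ω (max x 0) := hω.antitone_max (by linarith)
      have h2 : ω (max (-x) 0) ≤ ω (max (-(x + h)) 0) := hω.antitone_max (by linarith)
      rw [hω.eq_add_sub_one x, hω.eq_add_sub_one (x + h), abs_le]
      constructor <;> linarith
  refine hle.trans ?_
  rw [intervalIntegral.integral_add]
  · have h1 := integral_sub_comp_add_le hp (fun x => hω.mem_Icc _) (-1 - h) 1 hh
    have h2 := integral_sub_comp_add_le hq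
      (fun x => ⟨by linarith [hω.le_one (max (-x) 0)], by linarith [hω.nonneg (max (-x) 0)]⟩)
      (-1 - h) 1 hh
    linarith
  · exact (by fun_prop : Continuous fun x => ω (max x 0) - ω (max (x + h) 0)).intervalIntegrable _ _
  · exact (by fun_prop : Continuous fun x =>
      (1 - ω (max (-x) 0)) - (1 - ω (max (-(x + h)) 0))).intervalIntegrable _ _

theorem integrable (hω : IsWindowGenerator m σ ω) : Integrable ω :=
  hω.continuous.integrable_of_hasCompactSupport hω.hasCompactSupport

end IsWindowGenerator

theorem evenFourier_neg {φ : ℝ → ℝ} (hφ : Function.Even φ) (v : ℝ) :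
    evenFourier φ (-v) = evenFourier φ v := by
  simp only [evenFourier, Real.fourier_real_eq_integral_exp_smul]
  rw [← integral_neg_eq_self]
  congr 1
  refine integral_congr_ae (Eventually.of_forall fun t => ?_)
  simp only [hφ t]
  push_cast
  ring_nf

theorem evenFourier_abs {φ : ℝ → ℝ} (hφ : Function.Even φ) (v : ℝ) :
    evenFourier φ |v| = evenFourier φ v := by
  rcases abs_choice v with h | h <;> rw [h]
  exact evenFourier_neg hφ v

namespace IsWindowGenerator

variable {m : ℕ} {σ : ℝ} {ω : ℝ → ℝ}

/-- Translation by `1/(2ξ)` flips the sign of the exponential, so the transform is half the integral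
of `ω - ω(· + 1/(2ξ))` against a unimodular factor. -/
theorem abs_evenFourier_le (hω : IsWindowGenerator m σ ω) (ξ : ℝ) (hξ : ξ ≠ 0) :
    |evenFourier ω ξ| ≤ 1 / (2 * |ξ|) := by
  wlog hpos : 0 < ξ generalizing ξ
  · have := this (-ξ) (neg_ne_zero.2 hξ) (by
      rcases lt_trichotomy ξ 0 with h | h | h
      · linarith
      · exact absurd h hξ
      · exact absurd h hpos)
    rwa [evenFourier_neg hω.even, abs_neg] at this
  have hint : Integrable fun t => (ω t : ℂ) := hω.integrable.ofReal
  have h1 := fourierIntegral_eq_half_sub_half_period_translate hξ hint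
  have h2 : |evenFourier ω ξ| ≤ ‖𝓕 (fun t : ℝ => (ω t : ℂ)) ξ‖ := Complex.abs_re_le_norm _
  rw [Real.fourier_eq, h1] at h2
  beta_reduce at h2
  have h3 : (1 / (2 * ‖ξ‖ ^ 2)) • ξ = 1 / (2 * ξ) := by
    rw [Real.norm_eq_abs, sq_abs, smul_eq_mul]
    field_simp
  rw [h3, norm_smul] at h2
  refine h2.trans ?_
  have h4 : ‖∫ v : ℝ, 𝐞 (-inner ℝ v ξ) • ((ω v : ℂ) - (ω (v + 1 / (2 * ξ)) : ℂ))‖ ≤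
      2 * (1 / (2 * ξ)) := by
    refine (norm_integral_le_integral_norm _).trans
      (le_trans (le_of_eq ?_) (hω.integral_abs_sub_le (h := 1 / (2 * ξ)) (by positivity)))
    refine integral_congr_ae (Eventually.of_forall fun t => ?_)
    simp only [Circle.norm_smul]
    rw [← Complex.ofReal_sub, Complex.norm_real, Real.norm_eq_abs]
  rw [abs_of_pos hpos]
  have h5 : ‖(1 / 2 : ℂ)‖ = 1 / 2 := by norm_num
  rw [h5]
  linarith

end IsWindowGenerator

/-! ### Poisson summation for windows -/

/-- The modulated and dilated window `t ↦ m⁻¹ ω(t/m) exp(-2πiut)`. -/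
def modulatedWindow (ω : ℝ → ℝ) (m : ℕ) (u t : ℝ) : ℂ :=
  1 / (m : ℂ) * ω (t / m) * Complex.exp (-2 * Real.pi * Complex.I * u * t)

theorem fourier_modulatedWindow {ω : ℝ → ℝ} (hω : Function.Even ω) {m : ℕ} (hm : 0 < m) (u ξ : ℝ) :
    𝓕 (modulatedWindow ω m u) ξ = (evenFourier ω (m * (u + ξ)) : ℂ) := by
  have hm' : (0 : ℝ) < m := by exact_mod_cast hm
  have hmc : (m : ℂ) ≠ 0 := by exact_mod_cast hm.ne'
  rw [ofReal_evenFourier hω, Real.fourier_real_eq_integral_exp_smul,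
    Real.fourier_real_eq_integral_exp_smul]
  have h := Measure.integral_comp_div
    (fun t : ℝ => Complex.exp (((-2 * Real.pi * t * (m * (u + ξ)) : ℝ) : ℂ) * Complex.I) •
      (ω t : ℂ)) (m : ℝ)
  rw [abs_of_pos hm'] at h
  have h2 : ∀ t : ℝ, Complex.exp (((-2 * Real.pi * t * ξ : ℝ) : ℂ) * Complex.I) •
      modulatedWindow ω m u t = (1 / (m : ℂ)) *
        (Complex.exp (((-2 * Real.pi * (t / m) * (m * (u + ξ)) : ℝ) : ℂ) * Complex.I) •
        (ω (t / m) : ℂ)) := by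
    intro t
    have : ((-2 * Real.pi * (t / m) * (m * (u + ξ)) : ℝ) : ℂ) * Complex.I =
        ((-2 * Real.pi * t * ξ : ℝ) : ℂ) * Complex.I + (-2 * Real.pi * Complex.I * u * t) := by
      push_cast
      field_simp
      ring
    rw [this, Complex.exp_add, modulatedWindow]
    simp only [smul_eq_mul]
    ring
  simp_rw [h2]
  rw [integral_const_mul, h, Complex.real_smul, Complex.ofReal_natCast, one_div,
    inv_mul_cancel_left₀ hmc]

theorem evenFourier_window (ω : ℝ → ℝ) {m : ℕ} (hm : 0 < m) {N' : ℝ} (hN' : 0 < N') (v : ℝ) :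
    evenFourier (window ω m N') v = m / N' * evenFourier ω (m * (v / N')) := by
  have hm' : (0 : ℝ) < m := by exact_mod_cast hm
  simp only [evenFourier]
  rw [Real.fourier_real_eq_integral_exp_smul, Real.fourier_real_eq_integral_exp_smul]
  have h := Measure.integral_comp_mul_left
    (fun t : ℝ => Complex.exp (((-2 * Real.pi * t * (m * (v / N')) : ℝ) : ℂ) * Complex.I) •
      (ω t : ℂ)) (N' / m)
  rw [abs_of_pos (by positivity), inv_div] at h
  have h2 : ∀ t : ℝ, Complex.exp (((-2 * Real.pi * t * v : ℝ) : ℂ) * Complex.I) •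
      ((window ω m N' t : ℝ) : ℂ) =
        Complex.exp (((-2 * Real.pi * (N' / m * t) * (m * (v / N')) : ℝ) : ℂ) * Complex.I) •
        (ω (N' / m * t) : ℂ) := by
    intro t
    have : -2 * Real.pi * (N' / m * t) * (m * (v / N')) = -2 * Real.pi * t * v := by
      field_simp
    rw [this, window]
    congr 4
    ring
  simp_rw [h2]
  rw [h, Complex.smul_re, smul_eq_mul]

theorem even_window {ω : ℝ → ℝ} (hω : Function.Even ω) (m : ℕ) (N' : ℝ) :
    Function.Even (window ω m N') := by
  intro t
  rw [window, window, ← hω]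
  congr 1
  ring

namespace IsWindowGenerator

variable {m : ℕ} {σ : ℝ} {ω : ℝ → ℝ}

theorem continuous_modulatedWindow (hω : IsWindowGenerator m σ ω) (u : ℝ) :
    Continuous (modulatedWindow ω m u) := by
  have := hω.continuous
  unfold modulatedWindow
  fun_prop

theorem modulatedWindow_eq_zero (hω : IsWindowGenerator m σ ω) (hm : 0 < m) (u : ℝ) {t : ℝ}
    (ht : m ≤ |t|) : modulatedWindow ω m u t = 0 := by
  have hm' : (0 : ℝ) < m := by exact_mod_cast hm
  rw [modulatedWindow, hω.eq_zero_of_one_le_abs]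
  · simp
  · rw [abs_div, Nat.abs_cast, le_div_iff₀ hm', one_mul]
    exact ht

/-- Poisson summation: the periodization of the modulated window is continuous and has the numbers
`evenFourier ω (m * (u + r))` as Fourier coefficients. These are `O(1/r)`, which is what the
Tauberian criterion asks for. -/
theorem hasSum_evenFourier (hω : IsWindowGenerator m σ ω) (hm : 0 < m) {u : ℝ} (hu : |u| ≤ 1 / 2)
    (y : ℝ) :
    HasSum (fun r : ℤ => (evenFourier ω (m * (u + r)) : ℂ) *
      Complex.exp (2 * Real.pi * Complex.I * r * y)) (∑' l : ℤ, modulatedWindow ω m u (y + l))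
      (SummationFilter.symmetricIcc ℤ) := by
  have hm' : (0 : ℝ) < m := by exact_mod_cast hm
  let G : C(ℝ, ℂ) := ⟨modulatedWindow ω m u, hω.continuous_modulatedWindow u⟩
  -- The window has compact support, so any exponent would do; `-2` makes the periodization
  -- summable.
  have hO : (G : ℝ → ℂ) =O[cocompact ℝ] fun x : ℝ => |x| ^ (-2 : ℝ) := by
    have hz : ∀ᶠ x : ℝ in cocompact ℝ, G x = 0 := by
      filter_upwards [(isCompact_Icc (a := -(m : ℝ)) (b := m)).compl_mem_cocompact] with x hx
      apply hω.modulatedWindow_eq_zero hm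
      by_contra hlt
      exact hx (abs_le.1 (not_le.1 hlt).le)
    refine Asymptotics.IsBigO.congr' (Asymptotics.isBigO_zero (E' := ℂ) _ _) ?_ EventuallyEq.rfl
    filter_upwards [hz] with x hx using hx.symm
  have hsum : ∀ K : TopologicalSpace.Compacts ℝ,
      Summable fun n : ℤ => ‖(G.comp (ContinuousMap.addRight (n : ℝ))).restrict K‖ := fun K =>
    summable_of_isBigO (Real.summable_abs_int_rpow one_lt_two)
      ((isBigO_norm_restrict_cocompact G two_pos hO K).comp_tendsto Int.tendsto_coe_cofinite)
  let F : C(UnitAddCircle, ℂ) :=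
    ⟨(G.periodic_tsum_comp_add_zsmul 1).lift, continuous_coinduced_dom.mpr (map_continuous _)⟩
  have hF : ∀ r : ℤ, fourierCoeff F r = (evenFourier ω (m * (u + r)) : ℂ) := fun r =>
    (Real.fourierCoeff_tsum_comp_add hsum r).trans (fourier_modulatedWindow hω.even hm u r)
  have hFy : F (y : UnitAddCircle) = ∑' l : ℤ, modulatedWindow ω m u (y + l) := by
    have := (ContinuousMap.hasSum_apply
      (ContinuousMap.summable_of_locally_summable_norm hsum).hasSum y).tsum_eq
    simpa only [F, G, ContinuousMap.coe_mk, Function.Periodic.lift_coe, zsmul_one,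
      ContinuousMap.comp_apply, ContinuousMap.coe_addRight] using this.symm
  have hC : ∀ r : ℤ, r ≠ 0 → ‖fourierCoeff F r‖ ≤ (1 / m) / |(r : ℝ)| := by
    intro r hr
    have hr1 : 1 ≤ |(r : ℝ)| := by exact_mod_cast Int.one_le_abs hr
    -- Here `|u| ≤ 1/2` keeps the frequency `u + r` away from zero for every `r ≠ 0`.
    have hlow : |(r : ℝ)| / 2 ≤ |u + r| := by
      have := abs_sub_abs_le_abs_sub (r : ℝ) (-u)
      rw [abs_neg, sub_neg_eq_add, add_comm] at this
      linarith
    have hne : (m : ℝ) * (u + r) ≠ 0 := by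
      refine mul_ne_zero hm'.ne' (abs_pos.1 ?_)
      linarith
    rw [hF, Complex.norm_real, Real.norm_eq_abs]
    refine (hω.abs_evenFourier_le _ hne).trans ?_
    rw [abs_mul, Nat.abs_cast, div_div]
    apply one_div_le_one_div_of_le (by positivity)
    nlinarith
  have := tendsto_fourierPartialSum F hC y
  rw [hFy] at this
  rw [SummationFilter.hasSum_symmetricIcc_iff]
  refine this.congr fun n => Finset.sum_congr rfl fun r _ => ?_
  change fourierCoeff F r * fourier r (y : UnitAddCircle) = _
  rw [hF, fourier_coe_apply]
  simp

end IsWindowGenerator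

/-! ### The aliasing series and the error constants -/

namespace IsWindowGenerator

variable {m : ℕ} {σ : ℝ} {ω : ℝ → ℝ}

theorem evenFourier_ge (hω : IsWindowGenerator m σ ω) (hσ : 1 < σ) {ξ : ℝ}
    (hξ : |ξ| ≤ m / (2 * σ)) : evenFourier ω (m / (2 * σ)) ≤ evenFourier ω ξ := by
  rw [← evenFourier_abs hω.even ξ]
  exact hω.fourier_antitoneOn ⟨abs_nonneg ξ, hξ⟩ ⟨by positivity, le_rfl⟩ hξ

theorem evenFourier_endpoint_pos (hω : IsWindowGenerator m σ ω) (hσ : 1 < σ) :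
    0 < evenFourier ω (m / (2 * σ)) :=
  hω.fourier_pos _ ⟨by positivity, le_rfl⟩

theorem evenFourier_pos (hω : IsWindowGenerator m σ ω) (hσ : 1 < σ) {ξ : ℝ}
    (hξ : |ξ| ≤ m / (2 * σ)) : 0 < evenFourier ω ξ :=
  (hω.evenFourier_endpoint_pos hσ).trans_le (hω.evenFourier_ge hσ hξ)

/-- At most `2m + 1` translates meet the support, and each term is at most `1/m`; the total is at
most `2 + 1/m ≤ 3`. -/
theorem norm_tsum_modulatedWindow_le (hω : IsWindowGenerator m σ ω) (hm : 0 < m) (u y : ℝ) :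
    ‖∑' l : ℤ, modulatedWindow ω m u (y + l)‖ ≤ 3 := by
  have hm' : (1 : ℝ) ≤ m := by exact_mod_cast hm
  rw [tsum_eq_sum (s := Finset.Icc ⌈-y - m⌉ ⌊-y + m⌋)]
  · have hle : ∀ t : ℝ, ‖modulatedWindow ω m u t‖ ≤ 1 / m := by
      intro t
      have he : ‖Complex.exp (-2 * Real.pi * Complex.I * u * t)‖ = 1 := by
        have : (-2 * Real.pi * Complex.I * u * t : ℂ) =
            ((-2 * Real.pi * u * t : ℝ) : ℂ) * Complex.I := by push_cast; ring
        rw [this, Complex.norm_exp_ofReal_mul_I]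
      rw [modulatedWindow, norm_mul, he, mul_one, norm_mul, Complex.norm_real,
        Real.norm_of_nonneg (hω.nonneg _), norm_div, norm_one, Complex.norm_natCast]
      exact mul_le_of_le_one_right (by positivity) (hω.le_one _)
    refine (norm_sum_le _ _).trans ((Finset.sum_le_card_nsmul _ _ _ fun l _ => hle _).trans ?_)
    have hcard : ((Finset.Icc ⌈-y - m⌉ ⌊-y + m⌋).card : ℝ) ≤ 2 * m + 1 := by
      rw [Int.card_Icc]
      have h1 : (⌊-y + m⌋ : ℝ) ≤ -y + m := Int.floor_le _
      have h2 : -y - m ≤ (⌈-y - m⌉ : ℝ) := Int.le_ceil _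
      have h3 : ((⌊-y + m⌋ + 1 - ⌈-y - m⌉ : ℤ) : ℝ) ≤ ((2 * m + 1 : ℤ) : ℝ) := by
        push_cast; linarith
      have h4 : (⌊-y + m⌋ + 1 - ⌈-y - m⌉).toNat ≤ 2 * m + 1 := by
        have := Int.cast_le.1 h3
        omega
      exact_mod_cast h4
    rw [nsmul_eq_mul, mul_one_div, div_le_iff₀ (by positivity)]
    linarith
  · intro l hl
    apply hω.modulatedWindow_eq_zero hm
    by_contra hlt
    rw [not_le, abs_lt] at hlt
    exact hl (Finset.mem_Icc.2 ⟨Int.ceil_le.2 (by linarith), Int.le_floor.2 (by linarith)⟩)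

variable {N : ℕ} {N' : ℝ}

theorem abs_mul_div_le (hσ : 1 < σ) (hN : 1 ≤ N) (hN' : N' = σ * N) {w : ℝ}
    (hw : w ∈ Set.Icc (-(N : ℝ) / 2) (N / 2)) : |m * (w / N')| ≤ m / (2 * σ) := by
  have hN0 : (0 : ℝ) < N := by exact_mod_cast hN
  have h1 : |w| ≤ N / 2 := abs_le.2 ⟨by linarith [hw.1], hw.2⟩
  have h2 : 0 < σ * N := by positivity
  rw [hN', abs_mul, Nat.abs_cast, abs_div, abs_of_pos h2, div_eq_mul_one_div (m : ℝ) (2 * σ)]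
  refine mul_le_mul_of_nonneg_left ?_ (Nat.cast_nonneg m)
  rw [div_le_div_iff₀ h2 (by positivity)]
  nlinarith

theorem abs_div_le_half (hσ : 1 < σ) (hN : 1 ≤ N) (hN' : N' = σ * N) {w : ℝ}
    (hw : w ∈ Set.Icc (-(N : ℝ) / 2) (N / 2)) : |w / N'| ≤ 1 / 2 := by
  have hN0 : (0 : ℝ) < N := by exact_mod_cast hN
  have h := abs_mul_div_le (m := 1) hσ hN hN' hw
  rw [Nat.cast_one, one_mul] at h
  refine h.trans (one_div_le_one_div_of_le two_pos ?_)
  linarith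

theorem evenFourier_window_pos (hω : IsWindowGenerator m σ ω) (hm : 0 < m) (hσ : 1 < σ)
    (hN : 1 ≤ N) (hN' : N' = σ * N) {w : ℝ} (hw : w ∈ Set.Icc (-(N : ℝ) / 2) (N / 2)) :
    0 < evenFourier (window ω m N') w := by
  have hN0 : (0 : ℝ) < N := by exact_mod_cast hN
  have hm0 : (0 : ℝ) < m := by exact_mod_cast hm
  have hN'0 : 0 < N' := by rw [hN']; positivity
  rw [evenFourier_window ω hm hN'0]
  exact mul_pos (by positivity) (hω.evenFourier_pos hσ (abs_mul_div_le hσ hN hN' hw))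

theorem evenFourier_window_ge (hω : IsWindowGenerator m σ ω) (hm : 0 < m) (hσ : 1 < σ)
    (hN : 1 ≤ N) (hN' : N' = σ * N) {w : ℝ} (hw : w ∈ Set.Icc (-(N : ℝ) / 2) (N / 2)) :
    evenFourier (window ω m N') (N / 2) ≤ evenFourier (window ω m N') w := by
  have hN0 : (0 : ℝ) < N := by exact_mod_cast hN
  have hN'0 : 0 < N' := by rw [hN']; positivity
  rw [evenFourier_window ω hm hN'0, evenFourier_window ω hm hN'0]
  have : (m : ℝ) * (N / 2 / N') = m / (2 * σ) := by rw [hN']; field_simp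
  rw [this]
  exact mul_le_mul_of_nonneg_left (hω.evenFourier_ge hσ (abs_mul_div_le hσ hN hN' hw))
    (by positivity)

/-- Poisson summation divided by the term for `r = 0`, which becomes the subtracted `1`. The
bandwidth enters only through `w / N'` and `N' * x`, hence bounds uniform in `N`. -/
theorem aliasingSeries_eq (hω : IsWindowGenerator m σ ω) (hm : 0 < m) (hσ : 1 < σ) (hN : 1 ≤ N)
    (hN' : N' = σ * N) {w : ℝ} (hw : w ∈ Set.Icc (-(N : ℝ) / 2) (N / 2)) (x : ℝ) :
    aliasingSeries (window ω m N') N' w x =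
      (∑' l : ℤ, modulatedWindow ω m (w / N') (N' * x + l)) / (evenFourier ω (m * (w / N')) : ℂ)
        - 1 := by
  have hN0 : (0 : ℝ) < N := by exact_mod_cast hN
  have hm0 : (0 : ℝ) < m := by exact_mod_cast hm
  have hN'0 : 0 < N' := by rw [hN']; positivity
  have hpos := hω.evenFourier_pos hσ (abs_mul_div_le (m := m) hσ hN hN' hw)
  set Q : ℂ := (evenFourier ω (m * (w / N')) : ℂ) with hQ
  have hQ0 : Q ≠ 0 := by rw [hQ]; exact_mod_cast hpos.ne'
  have h := (hω.hasSum_evenFourier hm (abs_div_le_half hσ hN hN' hw) (N' * x)).div_const Q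
  rw [SummationFilter.hasSum_symmetricIcc_iff] at h
  refine HasSum.tsum_eq ?_
  rw [SummationFilter.hasSum_symmetricIcc_iff]
  refine (h.sub_const 1).congr fun n => ?_
  have hterm : ∀ r : ℤ, (if r = 0 then 0 else
      ((evenFourier (window ω m N') (w + r * N') / evenFourier (window ω m N') w : ℝ) : ℂ) *
      Complex.exp (2 * Real.pi * Complex.I * r * N' * x)) =
      (evenFourier ω (m * (w / N' + r)) : ℂ) *
        Complex.exp (2 * Real.pi * Complex.I * r * ((N' * x : ℝ) : ℂ)) / Q -
        if r = 0 then 1 else 0 := by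
    intro r
    split_ifs with hr
    · subst hr
      simp [← hQ, div_self hQ0]
    · rw [evenFourier_window ω hm hN'0, evenFourier_window ω hm hN'0,
        mul_div_mul_left _ _ (by positivity), add_div, mul_div_cancel_right₀ _ hN'0.ne']
      push_cast
      rw [← hQ]
      ring_nf
  rw [Finset.sum_congr rfl fun r _ => hterm r, Finset.sum_sub_distrib]
  simp

theorem norm_aliasingSeries_le_three (hω : IsWindowGenerator m σ ω) (hm : 0 < m) (hσ : 1 < σ)
    (hN : 1 ≤ N) (hN' : N' = σ * N) {w : ℝ} (hw : w ∈ Set.Icc (-(N : ℝ) / 2) (N / 2)) (x : ℝ) :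
    ‖aliasingSeries (window ω m N') N' w x‖ ≤ 3 / evenFourier ω (m / (2 * σ)) + 1 := by
  rw [hω.aliasingSeries_eq hm hσ hN hN' hw]
  refine (norm_sub_le _ _).trans ?_
  have hb := abs_mul_div_le (m := m) hσ hN hN' hw
  have hpos := hω.evenFourier_pos hσ hb
  have hpos' := hω.evenFourier_endpoint_pos hσ
  rw [norm_one, norm_div, Complex.norm_real, Real.norm_of_nonneg hpos.le]
  gcongr
  · exact hω.norm_tsum_modulatedWindow_le hm _ _
  · exact hω.evenFourier_ge hσ hb

theorem errorConstant_ne_top (hω : IsWindowGenerator m σ ω) (hm : 0 < m) (hσ : 1 < σ) :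
    errorConstant ω m σ ≠ ⊤ := by
  have : errorConstant ω m σ ≤ ENNReal.ofReal (3 / evenFourier ω (m / (2 * σ)) + 1) := by
    refine iSup₂_le fun N hN => iSup₂_le fun w hw => iSup₂_le fun x hx => ?_
    rw [← ofReal_norm]
    exact ENNReal.ofReal_le_ofReal (hω.norm_aliasingSeries_le_three hm hσ hN rfl hw x)
  exact ne_top_of_le_ne_top ENNReal.ofReal_ne_top this

theorem norm_aliasingSeries_le (hω : IsWindowGenerator m σ ω) (hm : 0 < m) (hσ : 1 < σ)
    (hN : 1 ≤ N) (hN' : N' = σ * N) {w : ℝ} (hw : w ∈ Set.Icc (-(N : ℝ) / 2) (N / 2)) {x : ℝ}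
    (hx : x ∈ Set.Icc (-1 / 2 : ℝ) (1 / 2)) :
    ‖aliasingSeries (window ω m N') N' w x‖ ≤ (errorConstant ω m σ).toReal := by
  have : ‖aliasingSeries (window ω m N') N' w x‖ₑ ≤ errorConstant ω m σ := by
    subst hN'
    exact (le_iSup₂_of_le w hw (le_iSup₂_of_le x hx le_rfl) :
      _ ≤ errorConstantAt ω m σ N).trans (le_iSup₂_of_le N hN le_rfl)
  rw [← toReal_enorm]
  exact ENNReal.toReal_mono (hω.errorConstant_ne_top hm hσ) this

/-- The identity behind both halves of the NNFFT: sampling the window reproduces the exponential up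
to the factor `1 +` aliasing series. The set `S` need only contain the samples inside the support.
-/
theorem sum_window_exp (hω : IsWindowGenerator m σ ω) (hm : 0 < m) (hσ : 1 < σ)
    (hN : 1 ≤ N) (hN' : N' = σ * N) {w : ℝ} (hw : w ∈ Set.Icc (-(N : ℝ) / 2) (N / 2)) (v : ℝ)
    (S : Finset ℤ) (hS : ∀ l : ℤ, l ∉ S → m ≤ |l - N' * v|) :
    1 / (N' : ℂ) * ∑ l ∈ S, (window ω m N' (l / N' - v) : ℂ) *
      Complex.exp (-2 * Real.pi * Complex.I * l * w / N') =
    (evenFourier (window ω m N') w : ℂ) * Complex.exp (-2 * Real.pi * Complex.I * w * v) *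
      (1 + aliasingSeries (window ω m N') N' w (-v)) := by
  have hN0 : (0 : ℝ) < N := by exact_mod_cast hN
  have hm0 : (0 : ℝ) < m := by exact_mod_cast hm
  have hN'0 : 0 < N' := by rw [hN']; positivity
  have hmc : (m : ℂ) ≠ 0 := by exact_mod_cast hm.ne'
  have hNc : (N' : ℂ) ≠ 0 := by exact_mod_cast hN'0.ne'
  have hQ0 : (evenFourier ω (m * (w / N')) : ℂ) ≠ 0 := by
    exact_mod_cast (hω.evenFourier_pos hσ (abs_mul_div_le (m := m) hσ hN hN' hw)).ne'
  rw [hω.aliasingSeries_eq hm hσ hN hN' hw, evenFourier_window ω hm hN'0, tsum_eq_sum (s := S)]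
  · have hterm : ∀ l : ℤ, (window ω m N' (l / N' - v) : ℂ) *
        Complex.exp (-2 * Real.pi * Complex.I * l * w / N') =
        m * Complex.exp (-2 * Real.pi * Complex.I * w * v) *
          modulatedWindow ω m (w / N') (N' * -v + l) := by
      intro l
      have h1 : N' * (l / N' - v) / m = (N' * -v + l) / m := by field_simp; ring
      have h2 : (-2 * Real.pi * Complex.I * l * w / N' : ℂ) =
          -2 * Real.pi * Complex.I * w * v +
            -2 * Real.pi * Complex.I * ((w / N' : ℝ) : ℂ) * ((N' * -v + l : ℝ) : ℂ) := by
        push_cast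
        field_simp
        ring
      rw [window, h1, h2, Complex.exp_add, modulatedWindow]
      field_simp
    rw [Finset.sum_congr rfl fun l _ => hterm l, ← Finset.mul_sum, Complex.ofReal_mul]
    generalize (evenFourier ω (m * (w / N')) : ℂ) = Q at hQ0 ⊢
    push_cast
    field_simp
    ring
  · intro l hl
    apply hω.modulatedWindow_eq_zero hm
    have := hS l hl
    rwa [show N' * -v + l = l - N' * v by ring]

end IsWindowGenerator

/-! ### Error of the NNFFT -/

theorem card_indexSet {M : ℕ} (hM : Even M) : (indexSet M).card = M := by
  obtain ⟨k, rfl⟩ := hM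
  rw [indexSet, Int.card_Ico]
  omega

theorem mem_indexSet_of_abs_lt {M : ℕ} (hM : Even M) {l : ℤ} (h : |(l : ℝ)| < M / 2) :
    l ∈ indexSet M := by
  obtain ⟨k, rfl⟩ := hM
  rw [abs_lt] at h
  push_cast at h
  have h1 : (-(k : ℤ) : ℝ) < l := by push_cast; linarith
  have h2 : (l : ℝ) < (k : ℤ) := by push_cast; linarith
  have h1' : -(k : ℤ) < l := by exact_mod_cast h1
  have h2' : l < (k : ℤ) := by exact_mod_cast h2
  rw [indexSet, Finset.mem_Ico]
  omega

theorem abs_le_of_mem_indexSet {M : ℕ} {l : ℤ} (h : l ∈ indexSet M) :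
    (l : ℝ) ∈ Set.Icc (-(M : ℝ) / 2) (M / 2) := by
  rw [indexSet, Finset.mem_Ico] at h
  have h1 : -(M : ℤ) ≤ 2 * l := by omega
  have h2 : 2 * l ≤ (M : ℤ) := by omega
  have h1' : -(M : ℝ) ≤ 2 * l := by exact_mod_cast h1
  have h2' : 2 * (l : ℝ) ≤ M := by exact_mod_cast h2
  constructor <;> linarith

section NNFFT

variable {ι : Type*} {N N₁ N₂ m₁ m₂ : ℕ} {σ₁ σ₂ : ℝ} {ω₁ ω₂ : ℝ → ℝ}

/-- The sums `s(Nx) = ∑_ℓ g_ℓ exp(-2πiℓx/σ₁)` which the last two steps of the NNFFT approximate. -/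
def nnfftExactS (φ₁ : ℝ → ℝ) (m₁ N₁ : ℕ) (σ₁ : ℝ) (S : Finset ι) (f : ι → ℂ) (v : ι → ℝ)
    (x : ℝ) : ℂ :=
  ∑ l ∈ indexSet (N₁ + 2 * m₁), nnfftG φ₁ N₁ S f v l *
    Complex.exp (-2 * Real.pi * Complex.I * l * (x / σ₁))

theorem norm_exp_two_pi_mul (a b : ℝ) : ‖Complex.exp (-2 * Real.pi * Complex.I * a * b)‖ = 1 := by
  have : (-2 * Real.pi * Complex.I * a * b : ℂ) = ((-2 * Real.pi * a * b : ℝ) : ℂ) * Complex.I := by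
    push_cast; ring
  rw [this, Complex.norm_exp_ofReal_mul_I]

/-- The sampling identity for the first window at frequency `Nx`, one node `v k` at a time; the
relative error is an aliasing series at `-v k`. -/
theorem norm_nnfftExactS_sub_le (hN : 1 ≤ N) (hσ₁ : 1 < σ₁) (hm₁ : 0 < m₁)
    (hN₁ : (N₁ : ℝ) = σ₁ * N) (hN₁even : Even N₁) (hω₁ : IsWindowGenerator m₁ σ₁ ω₁)
    (S : Finset ι) (f : ι → ℂ) (v : ι → ℝ) (hv : ∀ k ∈ S, v k ∈ Set.Icc (-1 / 2 : ℝ) (1 / 2))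
    {x : ℝ} (hx : x ∈ Set.Icc (-1 / 2 : ℝ) (1 / 2)) :
    ‖nnfftExactS (window ω₁ m₁ N₁) m₁ N₁ σ₁ S f v x / (evenFourier (window ω₁ m₁ N₁) (N * x) : ℂ) -
      ∑ k ∈ S, f k * Complex.exp (-2 * Real.pi * Complex.I * (N * x : ℝ) * v k)‖ ≤
      (errorConstant ω₁ m₁ σ₁).toReal * ∑ k ∈ S, ‖f k‖ := by
  have hN0 : (0 : ℝ) < N := by exact_mod_cast hN
  have hσ0 : (σ₁ : ℂ) ≠ 0 := by exact_mod_cast (by linarith : σ₁ ≠ 0)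
  have hNc : (N : ℂ) ≠ 0 := by exact_mod_cast (by omega : N ≠ 0)
  have hN₁c : (N₁ : ℂ) = σ₁ * N := by
    rw [← Complex.ofReal_natCast N₁, hN₁]; push_cast; rfl
  have hw : N * x ∈ Set.Icc (-(N : ℝ) / 2) (N / 2) :=
    ⟨by nlinarith [hx.1], by nlinarith [hx.2]⟩
  have hpos := hω₁.evenFourier_window_pos hm₁ hσ₁ hN hN₁ hw
  have hne : (evenFourier (window ω₁ m₁ N₁) (N * x) : ℂ) ≠ 0 := by exact_mod_cast hpos.ne'
  have hN₁pos : (0 : ℝ) < N₁ := by rw [hN₁]; positivity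
  have hkey : ∀ k ∈ S, 1 / (N₁ : ℂ) * ∑ l ∈ indexSet (N₁ + 2 * m₁),
      (window ω₁ m₁ N₁ (l / N₁ - v k) : ℂ) *
        Complex.exp (-2 * Real.pi * Complex.I * l * (x / σ₁)) =
      (evenFourier (window ω₁ m₁ N₁) (N * x) : ℂ) *
        Complex.exp (-2 * Real.pi * Complex.I * (N * x : ℝ) * v k) *
      (1 + aliasingSeries (window ω₁ m₁ N₁) N₁ (N * x) (-v k)) := by
    intro k hk
    rw [← hω₁.sum_window_exp hm₁ hσ₁ hN hN₁ hw (v k) (indexSet (N₁ + 2 * m₁))]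
    · rw [Complex.ofReal_natCast]
      congr 1
      refine Finset.sum_congr rfl fun l _ => ?_
      congr 2
      rw [hN₁c]
      push_cast
      field_simp
    · intro l hl
      by_contra hlt
      rw [not_le, abs_lt] at hlt
      -- Since `|N₁ * v k| ≤ N₁/2`, enlarging the index range by `m₁` on each side captures every
      -- sample where the window is nonzero.
      refine hl (mem_indexSet_of_abs_lt (hN₁even.add (even_two_mul m₁)) ?_)
      have h1 := hv k hk
      have h2 : -(N₁ / 2 : ℝ) ≤ N₁ * v k := by nlinarith [h1.1]
      have h3 : N₁ * v k ≤ (N₁ / 2 : ℝ) := by nlinarith [h1.2]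
      push_cast
      rw [abs_lt]
      constructor <;> linarith
  have hs : nnfftExactS (window ω₁ m₁ N₁) m₁ N₁ σ₁ S f v x =
      ∑ k ∈ S, f k * ((evenFourier (window ω₁ m₁ N₁) (N * x) : ℂ) *
        Complex.exp (-2 * Real.pi * Complex.I * (N * x : ℝ) * v k) *
      (1 + aliasingSeries (window ω₁ m₁ N₁) N₁ (N * x) (-v k))) := by
    rw [← Finset.sum_congr rfl fun k hk => congrArg (f k * ·) (hkey k hk)]
    simp only [nnfftExactS, nnfftG, Finset.mul_sum, Finset.sum_mul]
    rw [Finset.sum_comm]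
    refine Finset.sum_congr rfl fun k _ => Finset.sum_congr rfl fun l _ => ?_
    ring
  rw [hs, Finset.sum_div, ← Finset.sum_sub_distrib, Finset.mul_sum]
  refine norm_sum_le_of_le _ fun k hk => ?_
  have : f k * ((evenFourier (window ω₁ m₁ N₁) (N * x) : ℂ) *
        Complex.exp (-2 * Real.pi * Complex.I * (N * x : ℝ) * v k) *
      (1 + aliasingSeries (window ω₁ m₁ N₁) N₁ (N * x) (-v k))) /
        (evenFourier (window ω₁ m₁ N₁) (N * x) : ℂ) -
      f k * Complex.exp (-2 * Real.pi * Complex.I * (N * x : ℝ) * v k) =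
      f k * Complex.exp (-2 * Real.pi * Complex.I * (N * x : ℝ) * v k) *
        aliasingSeries (window ω₁ m₁ N₁) N₁ (N * x) (-v k) := by
    field_simp
    ring
  rw [this, norm_mul, norm_mul, norm_exp_two_pi_mul, mul_one, mul_comm]
  have hvk := hv k hk
  gcongr
  exact hω₁.norm_aliasingSeries_le hm₁ hσ₁ hN hN₁ hw
    ⟨by linarith [hvk.2], by linarith [hvk.1]⟩

theorem norm_nnfftG_le {σ : ℝ} (hω₁ : IsWindowGenerator m₁ σ ω₁)
    (S : Finset ι) (f : ι → ℂ) (v : ι → ℝ) (l : ℤ) :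
    ‖nnfftG (window ω₁ m₁ N₁) N₁ S f v l‖ ≤ 1 / N₁ * ∑ k ∈ S, ‖f k‖ := by
  rw [nnfftG, norm_mul, norm_div, norm_one, Complex.norm_natCast]
  gcongr
  refine norm_sum_le_of_le _ fun k _ => ?_
  rw [norm_mul, Complex.norm_real, window, Real.norm_of_nonneg (hω₁.nonneg _)]
  exact mul_le_of_le_one_right (norm_nonneg _) (hω₁.le_one _)

/-- The sampling identity for the second window, with frequency `ℓ` and node `x/σ₁`. The factor `a`
arises because `N₁ + 2m₁` indices `ℓ` each carry `|g_ℓ| ≤ (1/N₁) ∑ |f_k|`. -/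
theorem norm_nnfftS_sub_le (hN : 1 ≤ N) (hσ₁ : 1 < σ₁) (hσ₂ : 1 < σ₂) (hm₂ : 0 < m₂)
    (hN₁ : (N₁ : ℝ) = σ₁ * N) (hN₁even : Even N₁)
    (hN₂ : (N₂ : ℝ) = σ₂ * (N₁ + 2 * m₁)) (hN₂even : Even N₂)
    (hm₂N₂ : 2 * (m₂ : ℝ) ≤ (1 - 1 / σ₁) * N₂)
    (hω₁ : IsWindowGenerator m₁ σ₁ ω₁) (hω₂ : IsWindowGenerator m₂ σ₂ ω₂)
    (S : Finset ι) (f : ι → ℂ) (v : ι → ℝ)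
    {x : ℝ} (hx : x ∈ Set.Icc (-1 / 2 : ℝ) (1 / 2)) :
    ‖nnfftS (window ω₁ m₁ N₁) (window ω₂ m₂ N₂) m₁ m₂ N₁ N₂ σ₁ S f v x -
      nnfftExactS (window ω₁ m₁ N₁) m₁ N₁ σ₁ S f v x‖ ≤
      (1 + 2 * (m₁ : ℝ) / N₁) * (errorConstant ω₂ m₂ σ₂).toReal * ∑ k ∈ S, ‖f k‖ := by
  have hN0 : (0 : ℝ) < N := by exact_mod_cast hN
  have hN₁pos : (0 : ℝ) < N₁ := by rw [hN₁]; positivity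
  have hN₁' : 0 < N₁ := by exact_mod_cast hN₁pos
  have hN₂pos : (0 : ℝ) < N₂ := by rw [hN₂]; positivity
  have hM : 1 ≤ N₁ + 2 * m₁ := by omega
  have hN₂' : (N₂ : ℝ) = σ₂ * (N₁ + 2 * m₁ : ℕ) := by rw [hN₂]; push_cast; rfl
  have hx' : |x / σ₁| ≤ 1 / (2 * σ₁) := by
    have hxa : |x| ≤ 1 / 2 := abs_le.2 ⟨by linarith [hx.1], hx.2⟩
    rw [abs_div, abs_of_pos (by linarith : 0 < σ₁), ← div_div]
    gcongr
  have hx'' := abs_le.1 hx'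
  have hhalf : 1 / (2 * σ₁) ≤ 1 / 2 := one_div_le_one_div_of_le two_pos (by linarith)
  set J := (indexSet N₂).filter
    (fun s : ℤ => |(s : ℝ) / N₂ - x / σ₁| < (m₂ : ℝ) / N₂) with hJ
  have hJmem : ∀ s : ℤ, s ∉ J → m₂ ≤ |s - N₂ * (x / σ₁)| := by
    intro s hs
    by_contra hlt
    rw [not_le] at hlt
    apply hs
    rw [hJ, Finset.mem_filter]
    constructor
    · apply mem_indexSet_of_abs_lt hN₂even
      -- The condition on `m₂` says `N₂/(2σ₁) + m₂ ≤ N₂/2`, so a window centred at `x/σ₁` does not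
      -- leave the index range.
      have e1 : (1 - 1 / σ₁) * N₂ = N₂ - 2 * (N₂ * (1 / (2 * σ₁))) := by
        field_simp
      rw [e1] at hm₂N₂
      have e2 : N₂ * (x / σ₁) ≤ N₂ * (1 / (2 * σ₁)) :=
        mul_le_mul_of_nonneg_left hx''.2 hN₂pos.le
      have e3 : N₂ * -(1 / (2 * σ₁)) ≤ N₂ * (x / σ₁) :=
        mul_le_mul_of_nonneg_left hx''.1 hN₂pos.le
      rw [abs_lt] at hlt ⊢
      constructor <;> linarith
    · have : (s : ℝ) / N₂ - x / σ₁ = (s - N₂ * (x / σ₁)) / N₂ := by field_simp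
      rw [this, abs_div, Nat.abs_cast]
      gcongr
  have hkey : ∀ l ∈ indexSet (N₁ + 2 * m₁), 1 / (N₂ : ℂ) * ∑ s ∈ J,
      (window ω₂ m₂ N₂ (x / σ₁ - s / N₂) : ℂ) *
        Complex.exp (-2 * Real.pi * Complex.I * l * s / N₂) =
      (evenFourier (window ω₂ m₂ N₂) l : ℂ) *
        Complex.exp (-2 * Real.pi * Complex.I * l * (x / σ₁)) *
      (1 + aliasingSeries (window ω₂ m₂ N₂) N₂ l (-(x / σ₁))) := by
    intro l hl
    have := hω₂.sum_window_exp hm₂ hσ₂ hM hN₂' (abs_le_of_mem_indexSet hl) (x / σ₁) J hJmem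
    push_cast at this
    rw [← this]
    congr 1
    refine Finset.sum_congr rfl fun s _ => ?_
    rw [← even_window hω₂.even, neg_sub]
    congr 2
    ring
  have hs : nnfftS (window ω₁ m₁ N₁) (window ω₂ m₂ N₂) m₁ m₂ N₁ N₂ σ₁ S f v x =
      ∑ l ∈ indexSet (N₁ + 2 * m₁), nnfftG (window ω₁ m₁ N₁) N₁ S f v l /
        (evenFourier (window ω₂ m₂ N₂) l : ℂ) * ((evenFourier (window ω₂ m₂ N₂) l : ℂ) *
        Complex.exp (-2 * Real.pi * Complex.I * l * (x / σ₁)) *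
      (1 + aliasingSeries (window ω₂ m₂ N₂) N₂ l (-(x / σ₁)))) := by
    rw [← Finset.sum_congr rfl fun l hl => congrArg (nnfftG (window ω₁ m₁ N₁) N₁ S f v l /
        (evenFourier (window ω₂ m₂ N₂) l : ℂ) * ·) (hkey l hl)]
    rw [nnfftS, ← hJ]
    simp only [nnfftH, Finset.mul_sum, Finset.sum_mul]
    rw [Finset.sum_comm]
    refine Finset.sum_congr rfl fun l _ => Finset.sum_congr rfl fun s _ => ?_
    ring
  rw [hs, nnfftExactS, ← Finset.sum_sub_distrib]
  have hE0 : 0 ≤ (errorConstant ω₂ m₂ σ₂).toReal := ENNReal.toReal_nonneg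
  have hb : ∀ l ∈ indexSet (N₁ + 2 * m₁), ‖nnfftG (window ω₁ m₁ N₁) N₁ S f v l /
        (evenFourier (window ω₂ m₂ N₂) l : ℂ) * ((evenFourier (window ω₂ m₂ N₂) l : ℂ) *
        Complex.exp (-2 * Real.pi * Complex.I * l * (x / σ₁)) *
      (1 + aliasingSeries (window ω₂ m₂ N₂) N₂ l (-(x / σ₁)))) -
      nnfftG (window ω₁ m₁ N₁) N₁ S f v l *
        Complex.exp (-2 * Real.pi * Complex.I * l * (x / σ₁))‖ ≤
      (1 / N₁ * ∑ k ∈ S, ‖f k‖) * (errorConstant ω₂ m₂ σ₂).toReal := by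
    intro l hl
    have hw := abs_le_of_mem_indexSet hl
    have hne : (evenFourier (window ω₂ m₂ N₂) l : ℂ) ≠ 0 := by
      exact_mod_cast (hω₂.evenFourier_window_pos hm₂ hσ₂ hM hN₂' hw).ne'
    have e : nnfftG (window ω₁ m₁ N₁) N₁ S f v l /
        (evenFourier (window ω₂ m₂ N₂) l : ℂ) * ((evenFourier (window ω₂ m₂ N₂) l : ℂ) *
        Complex.exp (-2 * Real.pi * Complex.I * l * (x / σ₁)) *
      (1 + aliasingSeries (window ω₂ m₂ N₂) N₂ l (-(x / σ₁)))) -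
      nnfftG (window ω₁ m₁ N₁) N₁ S f v l *
        Complex.exp (-2 * Real.pi * Complex.I * l * (x / σ₁)) =
      nnfftG (window ω₁ m₁ N₁) N₁ S f v l *
        Complex.exp (-2 * Real.pi * Complex.I * (l : ℝ) * (x / σ₁ : ℝ)) *
        aliasingSeries (window ω₂ m₂ N₂) N₂ l (-(x / σ₁)) := by
      push_cast
      field_simp
      ring
    rw [e, norm_mul, norm_mul, norm_exp_two_pi_mul, mul_one]
    refine mul_le_mul (norm_nnfftG_le hω₁ S f v l) ?_ (norm_nonneg _) (by positivity)
    exact hω₂.norm_aliasingSeries_le hm₂ hσ₂ hM hN₂' hw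
      ⟨by linarith [hx''.2], by linarith [hx''.1]⟩
  refine (norm_sum_le_of_le _ hb).trans (le_of_eq ?_)
  rw [Finset.sum_const, card_indexSet (hN₁even.add (even_two_mul m₁)), nsmul_eq_mul]
  push_cast
  field_simp

theorem norm_nnfft_sub_le (hN : 1 ≤ N) (hσ₁ : 1 < σ₁) (hσ₂ : 1 < σ₂) (hm₁ : 0 < m₁) (hm₂ : 0 < m₂)
    (hN₁ : (N₁ : ℝ) = σ₁ * N) (hN₁even : Even N₁)
    (hN₂ : (N₂ : ℝ) = σ₂ * (N₁ + 2 * m₁)) (hN₂even : Even N₂)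
    (hm₂N₂ : 2 * (m₂ : ℝ) ≤ (1 - 1 / σ₁) * N₂)
    (hω₁ : IsWindowGenerator m₁ σ₁ ω₁) (hω₂ : IsWindowGenerator m₂ σ₂ ω₂)
    (S : Finset ι) (f : ι → ℂ) (v : ι → ℝ) (hv : ∀ k ∈ S, v k ∈ Set.Icc (-1 / 2 : ℝ) (1 / 2))
    {x : ℝ} (hx : x ∈ Set.Icc (-1 / 2 : ℝ) (1 / 2)) :
    ‖nnfft ω₁ ω₂ m₁ m₂ N N₁ N₂ σ₁ S f v x -
      ∑ k ∈ S, f k * Complex.exp (-2 * Real.pi * Complex.I * (N * x : ℝ) * v k)‖ ≤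
      errorFactor ω₁ ω₂ m₁ m₂ N N₁ σ₁ σ₂ * ∑ k ∈ S, ‖f k‖ := by
  have hN0 : (0 : ℝ) < N := by exact_mod_cast hN
  have hw : N * x ∈ Set.Icc (-(N : ℝ) / 2) (N / 2) :=
    ⟨by nlinarith [hx.1], by nlinarith [hx.2]⟩
  have hpos := hω₁.evenFourier_window_pos hm₁ hσ₁ hN hN₁ hw
  have hge := hω₁.evenFourier_window_ge hm₁ hσ₁ hN hN₁ hw
  have hpos' := hω₁.evenFourier_window_pos hm₁ hσ₁ hN hN₁ (w := N / 2) ⟨by linarith, le_rfl⟩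
  have h1 := norm_nnfftExactS_sub_le hN hσ₁ hm₁ hN₁ hN₁even hω₁ S f v hv hx
  have h2 := norm_nnfftS_sub_le hN hσ₁ hσ₂ hm₂ hN₁ hN₁even hN₂ hN₂even hm₂N₂ hω₁ hω₂ S f v hx
  set X := ∑ k ∈ S, f k * Complex.exp (-2 * Real.pi * Complex.I * (N * x : ℝ) * v k)
  set s := nnfftExactS (window ω₁ m₁ N₁) m₁ N₁ σ₁ S f v x
  set Q := evenFourier (window ω₁ m₁ N₁) (N * x)
  -- Dividing by the transform at `Nx` costs most at the band edge `N/2`, because the transform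
  -- decreases.
  have hsplit : nnfft ω₁ ω₂ m₁ m₂ N N₁ N₂ σ₁ S f v x - X =
      (nnfftS (window ω₁ m₁ N₁) (window ω₂ m₂ N₂) m₁ m₂ N₁ N₂ σ₁ S f v x - s) / (Q : ℂ) +
        (s / (Q : ℂ) - X) := by
    rw [nnfft]; ring
  have h3 : ‖(nnfftS (window ω₁ m₁ N₁) (window ω₂ m₂ N₂) m₁ m₂ N₁ N₂ σ₁ S f v x - s) / (Q : ℂ)‖ ≤
      (1 + 2 * (m₁ : ℝ) / N₁) * (errorConstant ω₂ m₂ σ₂).toReal * (∑ k ∈ S, ‖f k‖) /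
        evenFourier (window ω₁ m₁ N₁) (N / 2) := by
    rw [norm_div, Complex.norm_real, Real.norm_of_nonneg hpos.le]
    have : 0 ≤ (errorConstant ω₂ m₂ σ₂).toReal := ENNReal.toReal_nonneg
    gcongr
  rw [hsplit, errorFactor]
  refine (norm_add_le _ _).trans ((add_le_add h3 h1).trans (le_of_eq ?_))
  ring

end NNFFT

/-! ### Clenshaw–Curtis weights -/

section Weights

theorem ccEps_zero_sq (n : ℕ) : ccEps n 0 ^ 2 = 1 / 2 := by
  simp [ccEps, div_pow]; norm_num

theorem ccEps_self_sq (n : ℕ) : ccEps n n ^ 2 = 1 / 2 := by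
  simp [ccEps, div_pow]; norm_num

theorem ccEps_of_ne {n j : ℕ} (h0 : j ≠ 0) (hn : j ≠ n) : ccEps n j = 1 := by
  simp [ccEps, h0, hn]

/-- The trapezoidal sum. -/
theorem sum_ccEps_sq_mul {n : ℕ} (hn : 0 < n) (g : ℕ → ℝ) :
    ∑ k ∈ Finset.range (n + 1), ccEps n k ^ 2 * g k =
      ∑ k ∈ Finset.range n, (g k + g (k + 1)) / 2 := by
  obtain ⟨m, rfl⟩ : ∃ m, n = m + 1 := ⟨n - 1, by omega⟩
  have h1 : ∀ k ∈ Finset.range m, ccEps (m + 1) (k + 1) ^ 2 * g (k + 1) = g (k + 1) := by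
    intro k hk
    have := Finset.mem_range.1 hk
    rw [ccEps_of_ne (by omega) (by omega)]
    ring
  rw [Finset.sum_range_succ, Finset.sum_range_succ', Finset.sum_congr rfl h1, ccEps_zero_sq,
    ccEps_self_sq, ← Finset.sum_div, Finset.sum_add_distrib,
    Finset.sum_range_succ' (fun k => g k), Finset.sum_range_succ (fun k => g (k + 1))]
  ring

/-- Discrete orthogonality of cosines for the trapezoidal rule; unless all cosines are `1`,
multiplication by `sin(α/2)` makes the sum telescope to a multiple of `sin(pπ) = 0`. -/
theorem sum_ccEps_sq_mul_cos {n : ℕ} (hn : 0 < n) (p : ℤ) :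
    ∑ k ∈ Finset.range (n + 1), ccEps n k ^ 2 * Real.cos (p * (k * Real.pi / n)) =
      if (2 * n : ℤ) ∣ p then (n : ℝ) else 0 := by
  have hn' : (0 : ℝ) < n := by exact_mod_cast hn
  rw [sum_ccEps_sq_mul hn (fun k => Real.cos (p * (k * Real.pi / n)))]
  split_ifs with hp
  · obtain ⟨c, rfl⟩ := hp
    have h1 : ∀ k : ℕ, Real.cos (((2 * n * c : ℤ) : ℝ) * (k * Real.pi / n)) = 1 := by
      intro k
      rw [← Real.cos_int_mul_two_pi (c * k)]
      congr 1
      push_cast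
      field_simp
    simp only [h1]
    simp
  · set α : ℝ := p * (Real.pi / n) with hα
    have hs : Real.sin (α / 2) ≠ 0 := by
      intro h0
      obtain ⟨c, hc⟩ := Real.sin_eq_zero_iff.1 h0
      apply hp
      refine ⟨c, ?_⟩
      have h2 : (p : ℝ) = 2 * n * c := by
        rw [hα] at hc
        field_simp at hc
        rw [← hc]; ring
      exact_mod_cast h2
    have h4 : ∀ k : ℕ, (Real.cos (p * (k * Real.pi / n)) +
        Real.cos (p * ((k + 1 : ℕ) * Real.pi / n))) / 2 * Real.sin (α / 2) =
        Real.cos (α / 2) / 2 * (Real.sin ((k + 1 : ℕ) * α) - Real.sin (k * α)) := by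
      intro k
      have e1 : (p : ℝ) * (k * Real.pi / n) = (k * α + α / 2) - α / 2 := by rw [hα]; ring
      have e2 : (p : ℝ) * ((k + 1 : ℕ) * Real.pi / n) = (k * α + α / 2) + α / 2 := by
        rw [hα]; push_cast; ring
      have e3 : ((k + 1 : ℕ) : ℝ) * α = (k * α + α / 2) + α / 2 := by push_cast; ring
      have e4 : Real.sin (k * α) = Real.sin ((k * α + α / 2) - α / 2) := by congr 1; ring
      rw [e1, e2, e3, e4]
      generalize (k : ℝ) * α + α / 2 = x
      simp only [Real.cos_add, Real.cos_sub, Real.sin_add, Real.sin_sub]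
      ring
    have h5 : (∑ k ∈ Finset.range n, (Real.cos (p * (k * Real.pi / n)) +
        Real.cos (p * ((k + 1 : ℕ) * Real.pi / n))) / 2) * Real.sin (α / 2) = 0 := by
      rw [Finset.sum_mul, Finset.sum_congr rfl fun k _ => h4 k, ← Finset.mul_sum,
        Finset.sum_range_sub (fun k : ℕ => Real.sin (k * α))]
      have : (n : ℝ) * α = p * Real.pi := by rw [hα]; field_simp
      rw [this, Real.sin_int_mul_pi]
      simp
    exact (mul_eq_zero.1 h5).resolve_right hs

/-- The weights are a discrete cosine transform of the exact moments, so orthogonality recovers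
those moments: the rule is exact for `cos(2iθ)`, `i ≤ n/2`. -/
theorem sum_ccWeight_mul_cos {h : ℕ} (hh : 0 < h) {i : ℕ} (hi : i ≤ h) :
    ∑ k ∈ Finset.range (2 * h + 1), ccWeight (2 * h) k *
      Real.cos ((2 * i : ℤ) * (k * Real.pi / (2 * h : ℕ))) = 1 / (1 - 4 * (i : ℝ) ^ 2) := by
  set n := 2 * h with hn
  have hn0 : 0 < n := by omega
  have hn' : (n : ℝ) ≠ 0 := by exact_mod_cast hn0.ne'
  have hhalf : n / 2 = h := by omega
  have hinner : ∀ j ∈ Finset.range (h + 1), ∑ k ∈ Finset.range (n + 1),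
      ccEps n k ^ 2 * (Real.cos (2 * j * k * Real.pi / n) *
        Real.cos ((2 * i : ℤ) * (k * Real.pi / n))) =
      if j = i then (n : ℝ) / 2 * (if i = 0 ∨ i = h then 2 else 1) else 0 := by
    intro j hj
    have hj' : j ≤ h := by have := Finset.mem_range.1 hj; omega
    have e : ∀ k : ℕ, ccEps n k ^ 2 * (Real.cos (2 * j * k * Real.pi / n) *
        Real.cos ((2 * i : ℤ) * (k * Real.pi / n))) =
        (ccEps n k ^ 2 * Real.cos ((2 * j + 2 * i : ℤ) * (k * Real.pi / n)) +
        ccEps n k ^ 2 * Real.cos ((2 * j - 2 * i : ℤ) * (k * Real.pi / n))) / 2 := by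
      intro k
      have e1 : ((2 * j + 2 * i : ℤ) : ℝ) * (k * Real.pi / n) =
        2 * j * k * Real.pi / n + (2 * i : ℤ) * (k * Real.pi / n) := by push_cast; ring
      have e2 : ((2 * j - 2 * i : ℤ) : ℝ) * (k * Real.pi / n) =
        2 * j * k * Real.pi / n - (2 * i : ℤ) * (k * Real.pi / n) := by push_cast; ring
      rw [e1, e2, Real.cos_add, Real.cos_sub]
      ring
    rw [Finset.sum_congr rfl fun k _ => e k, ← Finset.sum_div, Finset.sum_add_distrib,
      sum_ccEps_sq_mul_cos hn0, sum_ccEps_sq_mul_cos hn0]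
    have d1 : (2 * n : ℤ) ∣ 2 * j - 2 * i ↔ j = i := by
      constructor
      · intro hd
        have := Int.eq_zero_of_abs_lt_dvd hd (by rw [abs_lt]; constructor <;> omega)
        omega
      · rintro rfl
        simp
    -- At the extreme indices `0` and `h` both cosines resonate; the resulting factor `2` cancels
    -- the `1/2` from `ccEps (2 * i) ^ 2`.
    have d2 : (2 * n : ℤ) ∣ 2 * j + 2 * i ↔ (j = 0 ∧ i = 0) ∨ (j = h ∧ i = h) := by
      constructor
      · intro hd
        by_cases hlt : j + i < 2 * h
        · have := Int.eq_zero_of_abs_lt_dvd hd (by rw [abs_lt]; constructor <;> omega)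
          omega
        · omega
      · rintro (⟨rfl, rfl⟩ | ⟨rfl, rfl⟩)
        · simp
        · exact ⟨1, by push_cast [hn]; ring⟩
    simp only [d1, d2]
    by_cases hji : j = i
    · subst hji
      by_cases hc : j = 0 ∨ j = h
      · have : (j = 0 ∧ j = 0) ∨ (j = h ∧ j = h) := by omega
        simp only [this, hc, if_true]
        ring
      · have : ¬((j = 0 ∧ j = 0) ∨ (j = h ∧ j = h)) := by omega
        simp only [this, hc, if_true, if_false]
        ring
    · have : ¬((j = 0 ∧ i = 0) ∨ (j = h ∧ i = h)) := by omega
      simp only [this, hji, if_false]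
      ring
  have hmain : ∑ k ∈ Finset.range (n + 1), ccWeight n k *
      Real.cos ((2 * i : ℤ) * (k * Real.pi / n)) = 1 / n * ∑ j ∈ Finset.range (h + 1),
      ccEps n (2 * j) ^ 2 * (2 / (1 - 4 * (j : ℝ) ^ 2)) * ∑ k ∈ Finset.range (n + 1),
      ccEps n k ^ 2 * (Real.cos (2 * j * k * Real.pi / n) *
        Real.cos ((2 * i : ℤ) * (k * Real.pi / n))) := by
    simp only [ccWeight, hhalf, Finset.mul_sum, Finset.sum_mul]
    rw [Finset.sum_comm]
    refine Finset.sum_congr rfl fun j _ => Finset.sum_congr rfl fun k _ => ?_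
    ring
  rw [hmain, Finset.sum_congr rfl fun j hj => congrArg (_ * ·) (hinner j hj),
    Finset.sum_eq_single i]
  · rw [if_pos rfl]
    by_cases hc : i = 0 ∨ i = h
    · have : ccEps n (2 * i) ^ 2 = 1 / 2 := by
        rcases hc with rfl | rfl
        · exact ccEps_zero_sq n
        · rw [← hn]; exact ccEps_self_sq n
      rw [if_pos hc, this]
      field_simp
    · rw [if_neg hc, ccEps_of_ne (by omega) (by omega)]
      field_simp
  · intro j _ hji
    rw [if_neg hji, mul_zero]
  · intro hni
    exact absurd (Finset.mem_range.2 (by omega)) hni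

theorem sum_ccWeight {h : ℕ} (hh : 0 < h) :
    ∑ k ∈ Finset.range (2 * h + 1), ccWeight (2 * h) k = 1 := by
  simpa using sum_ccWeight_mul_cos hh (Nat.zero_le h)

theorem sum_two_div_four_sq_sub_one (J : ℕ) :
    ∑ j ∈ Finset.range J, 2 / (4 * ((j : ℝ) + 1) ^ 2 - 1) = 1 - 1 / (2 * (J : ℝ) + 1) := by
  induction J with
  | zero => simp
  | succ J ih =>
    rw [Finset.sum_range_succ, ih]
    have h1 : 4 * ((J : ℝ) + 1) ^ 2 - 1 = (2 * J + 1) * (2 * J + 3) := by ring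
    have h2 : (2 * (J : ℝ) + 1) ≠ 0 := by positivity
    have h3 : (2 * (J : ℝ) + 3) ≠ 0 := by positivity
    have h4 : (2 * ((J + 1 : ℕ) : ℝ) + 1) = 2 * J + 3 := by push_cast; ring
    rw [h1, h4]
    field_simp
    ring

/-- The term `j = 0` equals `1`. With `h = J + 1`, the middle terms sum to at least `-(1 -
1/(2J+1))` by telescoping, and the last one is at least `-1/((2J+1)(2J+3))`. -/
theorem ccWeight_nonneg {h : ℕ} (hh : 0 < h) (k : ℕ) : 0 ≤ ccWeight (2 * h) k := by
  have hhalf : 2 * h / 2 = h := by omega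
  rw [ccWeight, hhalf]
  refine mul_nonneg (by positivity) ?_
  obtain ⟨J, rfl⟩ : ∃ J, h = J + 1 := ⟨h - 1, by omega⟩
  rw [Finset.sum_range_succ, Finset.sum_range_succ']
  have hq : ∀ j : ℕ, 0 < 4 * ((j : ℝ) + 1) ^ 2 - 1 := fun j => by
    have : (0 : ℝ) ≤ j := Nat.cast_nonneg j
    nlinarith
  have hterm : ∀ (x : ℝ) (j : ℕ), -(2 / (4 * ((j : ℝ) + 1) ^ 2 - 1)) ≤
      2 / (1 - 4 * (((j + 1 : ℕ) : ℝ)) ^ 2) * Real.cos x := by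
    intro x j
    have e : 2 / (1 - 4 * (((j + 1 : ℕ) : ℝ)) ^ 2) = -(2 / (4 * ((j : ℝ) + 1) ^ 2 - 1)) := by
      rw [← div_neg]; congr 1; push_cast; ring
    rw [e, neg_mul]
    exact neg_le_neg (mul_le_of_le_one_right (div_nonneg two_pos.le (hq j).le) (Real.cos_le_one x))
  have hmid : -(1 - 1 / (2 * (J : ℝ) + 1)) ≤ ∑ j ∈ Finset.range J,
      ccEps (2 * (J + 1)) (2 * (j + 1)) ^ 2 * (2 / (1 - 4 * (((j + 1 : ℕ) : ℝ)) ^ 2)) *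
        Real.cos (2 * ((j + 1 : ℕ) : ℝ) * k * Real.pi / (2 * (J + 1) : ℕ)) := by
    rw [← sum_two_div_four_sq_sub_one, ← Finset.sum_neg_distrib]
    refine Finset.sum_le_sum fun j hj => ?_
    have := Finset.mem_range.1 hj
    rw [ccEps_of_ne (by omega) (by omega), one_pow, one_mul]
    exact hterm _ j
  have hlast := hterm (2 * ((J + 1 : ℕ) : ℝ) * k * Real.pi / (2 * (J + 1) : ℕ)) J
  have hJ : (0 : ℝ) ≤ J := Nat.cast_nonneg J
  have hfin : 1 / (4 * ((J : ℝ) + 1) ^ 2 - 1) ≤ 1 / (2 * (J : ℝ) + 1) :=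
    one_div_le_one_div_of_le (by positivity) (by nlinarith)
  have e2 : 2 / (4 * ((J : ℝ) + 1) ^ 2 - 1) = 2 * (1 / (4 * ((J : ℝ) + 1) ^ 2 - 1)) := by ring
  rw [e2] at hlast
  rw [ccEps_self_sq, mul_assoc (1 / 2 : ℝ)]
  simp only [mul_zero, ccEps_zero_sq, Nat.cast_zero]
  norm_num only [Real.cos_zero, zero_mul, zero_div] at hmid hlast hfin ⊢
  linarith

theorem ccWeight_reflect {h k : ℕ} (hh : 0 < h) (hk : k ≤ 2 * h) :
    ccWeight (2 * h) (2 * h - k) = ccWeight (2 * h) k := by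
  have hh' : (h : ℝ) ≠ 0 := by exact_mod_cast hh.ne'
  have he : ccEps (2 * h) (2 * h - k) = ccEps (2 * h) k := by
    rw [ccEps, ccEps]
    congr 1
    apply propext
    omega
  rw [ccWeight, ccWeight, he]
  congr 1
  refine Finset.sum_congr rfl fun j _ => ?_
  congr 1
  have : 2 * (j : ℝ) * ((2 * h - k : ℕ) : ℝ) * Real.pi / (2 * h : ℕ) =
      j * (2 * Real.pi) - 2 * j * k * Real.pi / (2 * h : ℕ) := by
    rw [Nat.cast_sub hk]
    push_cast
    field_simp
  rw [this, Real.cos_nat_mul_two_pi_sub]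

theorem chebyshevPoint_reflect {n k : ℕ} (hn : 0 < n) (hk : k ≤ n) :
    chebyshevPoint n (n - k) = -chebyshevPoint n k := by
  have hn' : (n : ℝ) ≠ 0 := by exact_mod_cast hn.ne'
  rw [chebyshevPoint, chebyshevPoint, ← Real.cos_pi_sub, Nat.cast_sub hk]
  congr 1
  field_simp

/-- Weights are symmetric and nodes antisymmetric under `k ↦ n - k`, so the sine part cancels. -/
theorem sum_ccWeight_mul_exp {h : ℕ} (hh : 0 < h) (β : ℝ) :
    ∑ k ∈ Finset.range (2 * h + 1), (ccWeight (2 * h) k : ℂ) *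
      Complex.exp ((β * chebyshevPoint (2 * h) k : ℝ) * Complex.I) =
    ∑ k ∈ Finset.range (2 * h + 1), (ccWeight (2 * h) k : ℂ) *
      (Real.cos (β * chebyshevPoint (2 * h) k) : ℂ) := by
  have h1 : ∑ k ∈ Finset.range (2 * h + 1), ccWeight (2 * h) k *
      Real.sin (β * chebyshevPoint (2 * h) k) = 0 := by
    have h2 := Finset.sum_range_reflect (fun k => ccWeight (2 * h) k *
      Real.sin (β * chebyshevPoint (2 * h) k)) (2 * h + 1)
    have h3 : ∀ k ∈ Finset.range (2 * h + 1), ccWeight (2 * h) (2 * h + 1 - 1 - k) *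
        Real.sin (β * chebyshevPoint (2 * h) (2 * h + 1 - 1 - k)) =
        -(ccWeight (2 * h) k * Real.sin (β * chebyshevPoint (2 * h) k)) := by
      intro k hk
      have hk' : k ≤ 2 * h := by have := Finset.mem_range.1 hk; omega
      rw [Nat.add_sub_cancel, ccWeight_reflect hh hk', chebyshevPoint_reflect (by omega) hk',
        mul_neg, Real.sin_neg, mul_neg]
    rw [Finset.sum_congr rfl h3, Finset.sum_neg_distrib] at h2
    linarith
  have h4 : ∀ k, (ccWeight (2 * h) k : ℂ) *
      Complex.exp ((β * chebyshevPoint (2 * h) k : ℝ) * Complex.I) =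
      (ccWeight (2 * h) k : ℂ) * (Real.cos (β * chebyshevPoint (2 * h) k) : ℂ) +
      ((ccWeight (2 * h) k * Real.sin (β * chebyshevPoint (2 * h) k) : ℝ) : ℂ) * Complex.I := by
    intro k
    rw [Complex.exp_mul_I, Complex.ofReal_mul (ccWeight (2 * h) k), Complex.ofReal_cos,
      Complex.ofReal_sin]
    ring
  rw [Finset.sum_congr rfl fun k _ => h4 k, Finset.sum_add_distrib, ← Finset.sum_mul,
    ← Complex.ofReal_sum, h1]
  simp

end Weights

/-! ### Clenshaw–Curtis quadrature of the sinc kernel -/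

section ClenshawCurtis

/-- Cauchy's theorem on a rectangle of width one period: the vertical sides cancel. -/
theorem integral_periodic_eq_shift {g : ℂ → ℂ} (hg : Differentiable ℂ g)
    (hper : ∀ z, g (z + 1) = g z) (y : ℝ) :
    ∫ x in (0 : ℝ)..1, g x = ∫ x in (0 : ℝ)..1, g (x + y * Complex.I) := by
  have h := Complex.integral_boundary_rect_eq_zero_of_differentiableOn g 0 (1 + y * Complex.I)
    hg.differentiableOn
  have h1 : ∀ t : ℝ, g (1 + t * Complex.I) = g (t * Complex.I) := fun t => by
    rw [add_comm, hper]
  simp [h1] at h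
  linear_combination h

theorem norm_cos_le_cosh_im (z : ℂ) : ‖Complex.cos z‖ ≤ Real.cosh z.im := by
  rw [Complex.cos, norm_div, Complex.norm_two, Real.cosh_eq]
  gcongr
  refine (norm_add_le _ _).trans (le_of_eq ?_)
  rw [Complex.norm_exp, Complex.norm_exp]
  simp [add_comm]

variable (β : ℝ)

/-- The function `t ↦ cos(β cos(πt))` on the circle `ℝ/ℤ`. -/
def cosCos : C(UnitAddCircle, ℂ) :=
  ⟨Function.Periodic.lift (f := fun t : ℝ => (Real.cos (β * Real.cos (Real.pi * t)) : ℂ)) (c := 1)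
    (fun t => by simp only [mul_add, mul_one, Real.cos_add_pi, mul_neg, Real.cos_neg]),
    continuous_coinduced_dom.mpr
      (by fun_prop : Continuous fun t : ℝ => (Real.cos (β * Real.cos (Real.pi * t)) : ℂ))⟩

theorem cosCos_coe (t : ℝ) :
    cosCos β (t : UnitAddCircle) = (Real.cos (β * Real.cos (Real.pi * t)) : ℂ) := rfl

theorem norm_fourierCoeff_cosCos_le_shift (s : ℤ) (y : ℝ) : ‖fourierCoeff (cosCos β) s‖ ≤
    Real.cosh (|β| * |Real.sinh (Real.pi * y)|) * Real.exp (2 * Real.pi * s * y) := by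
  let g : ℂ → ℂ := fun z => Complex.exp (-(2 * Real.pi * Complex.I * s * z)) *
    Complex.cos (β * Complex.cos (Real.pi * z))
  have hg : Differentiable ℂ g := by fun_prop
  have hper : ∀ z, g (z + 1) = g z := by
    intro z
    simp only [g]
    have h1 : (-(2 * Real.pi * Complex.I * s * (z + 1)) : ℂ) =
        -(2 * Real.pi * Complex.I * s * z) + (-s : ℤ) * (2 * Real.pi * Complex.I) := by
      push_cast; ring
    rw [h1, Complex.exp_add, Complex.exp_int_mul_two_pi_mul_I, mul_one, mul_add, mul_one,
      Complex.cos_add_pi, mul_neg, Complex.cos_neg]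
  have h0 : fourierCoeff (cosCos β) s = ∫ x in (0 : ℝ)..1, g x := by
    rw [fourierCoeff_eq_intervalIntegral _ _ 0]
    simp only [div_one, one_smul, zero_add]
    refine intervalIntegral.integral_congr fun x _ => ?_
    simp only [g]
    rw [fourier_coe_apply, cosCos_coe, smul_eq_mul]
    push_cast
    congr 2
    ring
  rw [h0, integral_periodic_eq_shift hg hper y]
  refine (intervalIntegral.norm_integral_le_of_norm_le_const (C := Real.cosh
    (|β| * |Real.sinh (Real.pi * y)|) * Real.exp (2 * Real.pi * s * y)) fun x _ => ?_).trans ?_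
  · simp only [g]
    rw [norm_mul, mul_comm, Complex.norm_exp]
    have h2 : (-(2 * Real.pi * Complex.I * s * (x + y * Complex.I)) : ℂ).re =
        2 * Real.pi * s * y := by
      simp
    rw [h2]
    gcongr
    refine (norm_cos_le_cosh_im _).trans (Real.cosh_le_cosh.2 ?_)
    have h3 : (β * Complex.cos (Real.pi * (x + y * Complex.I)) : ℂ).im =
        -(β * (Real.sin (Real.pi * x) * Real.sinh (Real.pi * y))) := by
      have h4 : (β * Complex.cos (Real.pi * (x + y * Complex.I)) : ℂ) =
          ((β * (Real.cos (Real.pi * x) * Real.cosh (Real.pi * y)) : ℝ) : ℂ) +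
          ((-(β * (Real.sin (Real.pi * x) * Real.sinh (Real.pi * y))) : ℝ) : ℂ) * Complex.I := by
        rw [mul_add, ← mul_assoc, Complex.cos_add_mul_I]
        push_cast
        ring
      rw [h4, Complex.add_im, Complex.ofReal_im, Complex.im_ofReal_mul, Complex.I_im, mul_one,
        zero_add]
    rw [h3, abs_neg, abs_mul, abs_mul, abs_of_nonneg (a := |β| * |Real.sinh (Real.pi * y)|)
      (by positivity)]
    gcongr
    exact mul_le_of_le_one_left (abs_nonneg _) (Real.abs_sin_le_one _)
  · simp

/-- The contour is shifted by `1/π` in the direction in which the exponential decays; then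
`|sinh(πy)| = sinh 1` and the decay factor is `exp(-2|s|)`. -/
theorem norm_fourierCoeff_cosCos_le (s : ℤ) : ‖fourierCoeff (cosCos β) s‖ ≤
    Real.cosh (|β| * Real.sinh 1) * Real.exp (-(2 * |(s : ℝ)|)) := by
  have hs : 0 < Real.sinh 1 := Real.sinh_pos_iff.2 one_pos
  rcases le_total 0 (s : ℝ) with h | h
  · refine (norm_fourierCoeff_cosCos_le_shift β s (-(1 / Real.pi))).trans (le_of_eq ?_)
    have e1 : Real.pi * -(1 / Real.pi) = -1 := by field_simp
    have e2 : 2 * Real.pi * s * -(1 / Real.pi) = -(2 * s) := by field_simp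
    rw [e1, e2, abs_of_nonneg h, Real.sinh_neg, abs_neg, abs_of_pos hs]
  · refine (norm_fourierCoeff_cosCos_le_shift β s (1 / Real.pi)).trans (le_of_eq ?_)
    have e1 : Real.pi * (1 / Real.pi) = 1 := by field_simp
    have e2 : 2 * Real.pi * s * (1 / Real.pi) = -(2 * -s) := by field_simp
    rw [e1, e2, abs_of_nonpos h, abs_of_pos hs]

/-- A two-sided geometric series with the terms `|s| ≤ h` left out. -/
theorem hasSum_tail_exp (h : ℕ) :
    HasSum (fun s : ℤ => if s.natAbs ≤ h then 0 else Real.exp (-(2 * |(s : ℝ)|)))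
      (2 * (Real.exp (-(2 * h)) / (Real.exp 1 ^ 2 - 1))) := by
  have hq : Real.exp (-2) < 1 := by simp
  have hE : Real.exp 1 ^ 2 = Real.exp 2 := by rw [← Real.exp_nat_mul]; norm_num
  have hE1 : 1 < Real.exp 2 := Real.one_lt_exp_iff.2 two_pos
  have hgeo : HasSum (fun k : ℕ => Real.exp (-(2 * (h + 1))) * Real.exp (-2) ^ k)
      (Real.exp (-(2 * h)) / (Real.exp 1 ^ 2 - 1)) := by
    convert! (hasSum_geometric_of_lt_one (Real.exp_pos (-2)).le hq).mul_left
      (Real.exp (-(2 * ((h : ℝ) + 1)))) using 1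
    have e1 : Real.exp (-(2 * ((h : ℝ) + 1))) = Real.exp (-(2 * h)) / Real.exp 2 := by
      rw [← Real.exp_sub]; congr 1; ring
    rw [hE, e1, Real.exp_neg 2]
    have : Real.exp 2 - 1 ≠ 0 := by linarith
    field_simp
  have hterm : ∀ k : ℕ, Real.exp (-(2 * (h + 1))) * Real.exp (-2) ^ k =
      Real.exp (-(2 * ((k : ℝ) + h + 1))) := by
    intro k
    rw [← Real.exp_nat_mul, ← Real.exp_add]
    congr 1
    ring
  simp only [hterm] at hgeo
  rw [two_mul]
  apply HasSum.of_nat_of_neg_add_one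
  · rw [← hasSum_nat_add_iff' (h + 1), Finset.sum_eq_zero, sub_zero]
    · refine hgeo.congr_fun fun k => ?_
      rw [if_neg (by omega)]
      push_cast
      rw [abs_of_nonneg (by positivity)]
      ring_nf
    · intro k hk
      have := Finset.mem_range.1 hk
      rw [if_pos (by omega)]
  -- Negative integers are indexed as `-(k+1)`, so here `h` terms vanish, against `h + 1` on the
  -- nonnegative side.
  · rw [← hasSum_nat_add_iff' h, Finset.sum_eq_zero, sub_zero]
    · refine hgeo.congr_fun fun k => ?_
      rw [if_neg (by omega)]
      push_cast
      rw [abs_neg, abs_of_nonneg (by positivity)]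
    · intro k hk
      have := Finset.mem_range.1 hk
      rw [if_pos (by omega)]

theorem summable_fourierCoeff_cosCos : Summable (fourierCoeff (cosCos β)) := by
  have h1 : Summable fun s : ℤ => Real.exp (-(2 * |(s : ℝ)|)) := by
    refine (summable_congr_cofinite ?_).1 (hasSum_tail_exp 0).summable
    rw [EventuallyEq, eventually_cofinite]
    refine (Set.finite_singleton (0 : ℤ)).subset fun s hs => ?_
    by_contra hs'
    apply hs
    rw [Set.mem_singleton_iff] at hs'
    rw [if_neg (by omega)]
  exact Summable.of_norm_bounded (h1.mul_left _) (norm_fourierCoeff_cosCos_le β)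

/-- Averaging the Fourier series at `θ/π` and `-θ/π` turns exponentials into cosines, since the
function is even. -/
theorem hasSum_cosCos (θ : ℝ) :
    HasSum (fun s : ℤ => fourierCoeff (cosCos β) s * (Real.cos (2 * s * θ) : ℂ))
      (Real.cos (β * Real.cos θ) : ℂ) := by
  have h := has_pointwise_sum_fourier_series_of_summable (summable_fourierCoeff_cosCos β)
  have h1 := h ((θ / Real.pi : ℝ) : UnitAddCircle)
  have h2 := h ((-(θ / Real.pi) : ℝ) : UnitAddCircle)
  have e1 : Real.pi * (θ / Real.pi) = θ := by field_simp
  rw [cosCos_coe] at h1 h2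
  rw [mul_neg, e1, Real.cos_neg] at h2
  rw [e1] at h1
  convert! (h1.add h2).div_const 2 using 1
  · funext s
    rw [fourier_coe_apply, fourier_coe_apply, Complex.ofReal_cos, Complex.cos, smul_eq_mul,
      smul_eq_mul, ← mul_add, mul_div_assoc]
    have hpi : (Real.pi : ℂ) ≠ 0 := by exact_mod_cast Real.pi_ne_zero
    congr 4
    · push_cast; field_simp
    · push_cast; field_simp
  · ring

theorem integral_cos_mul_sin (s : ℤ) :
    ∫ θ in (0 : ℝ)..Real.pi, Real.cos (2 * s * θ) * Real.sin θ = 2 / (1 - 4 * (s : ℝ) ^ 2) := by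
  have h1 : (2 * (s : ℝ) + 1) ≠ 0 := by
    have : (2 * s + 1 : ℤ) ≠ 0 := by omega
    exact_mod_cast this
  have h2 : (2 * (s : ℝ) - 1) ≠ 0 := by
    have : (2 * s - 1 : ℤ) ≠ 0 := by omega
    exact_mod_cast this
  have hd : ∀ θ ∈ Set.uIcc (0 : ℝ) Real.pi, HasDerivAt (fun θ : ℝ =>
      -Real.cos ((2 * s + 1) * θ) / (2 * (2 * s + 1)) + Real.cos ((2 * s - 1) * θ) /
        (2 * (2 * s - 1))) (Real.cos (2 * s * θ) * Real.sin θ) θ := by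
    intro θ _
    have d1 := (((hasDerivAt_id θ).const_mul (2 * (s : ℝ) + 1)).cos.neg).div_const
      (2 * (2 * (s : ℝ) + 1))
    have d2 := (((hasDerivAt_id θ).const_mul (2 * (s : ℝ) - 1)).cos).div_const
      (2 * (2 * (s : ℝ) - 1))
    convert! d1.add d2 using 1
    simp only [id]
    have e1 : (2 * (s : ℝ) + 1) * θ = 2 * s * θ + θ := by ring
    have e2 : (2 * (s : ℝ) - 1) * θ = 2 * s * θ - θ := by ring
    rw [e1, e2, Real.sin_add, Real.sin_sub]
    field_simp
    ring
  rw [intervalIntegral.integral_eq_sub_of_hasDerivAt hd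
    ((by fun_prop : Continuous fun θ : ℝ =>
      Real.cos (2 * s * θ) * Real.sin θ).intervalIntegrable _ _)]
  have c1 : Real.cos ((2 * s + 1) * Real.pi) = -1 := by
    have : (2 * (s : ℝ) + 1) * Real.pi = s * (2 * Real.pi) + Real.pi := by ring
    rw [this, Real.cos_int_mul_two_pi_add_pi]
  have c2 : Real.cos ((2 * s - 1) * Real.pi) = -1 := by
    have : (2 * (s : ℝ) - 1) * Real.pi = s * (2 * Real.pi) - Real.pi := by ring
    rw [this, Real.cos_int_mul_two_pi_sub_pi]
  have h3 : 1 - 4 * (s : ℝ) ^ 2 = -((2 * s + 1) * (2 * s - 1)) := by ring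
  rw [c1, c2, h3]
  simp only [mul_zero, Real.cos_zero]
  field_simp
  ring

theorem integral_cos_cos_mul_sin :
    ∫ θ in (0 : ℝ)..Real.pi, Real.cos (β * Real.cos θ) * Real.sin θ = 2 * Real.sinc β := by
  by_cases hβ : β = 0
  · subst hβ
    simp [Real.sinc_zero]
    norm_num
  · have hd : ∀ θ ∈ Set.uIcc (0 : ℝ) Real.pi, HasDerivAt (fun θ : ℝ =>
        -Real.sin (β * Real.cos θ) / β) (Real.cos (β * Real.cos θ) * Real.sin θ) θ := by
      intro θ _
      convert! ((((Real.hasDerivAt_cos θ).const_mul β).sin).neg).div_const β using 1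
      field_simp
    rw [intervalIntegral.integral_eq_sub_of_hasDerivAt hd
      ((by fun_prop : Continuous fun θ : ℝ =>
        Real.cos (β * Real.cos θ) * Real.sin θ).intervalIntegrable _ _),
      Real.sinc_of_ne_zero hβ, Real.cos_pi, Real.cos_zero, mul_neg, mul_one, Real.sin_neg]
    ring

/-- The cosine expansion is integrated termwise against `sin θ` over `[0, π]`, with the summable
coefficients as dominating series. -/
theorem hasSum_sinc :
    HasSum (fun s : ℤ => fourierCoeff (cosCos β) s * ((1 / (1 - 4 * (s : ℝ) ^ 2) : ℝ) : ℂ))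
      (Real.sinc β : ℂ) := by
  have h := intervalIntegral.hasSum_integral_of_dominated_convergence (μ := volume)
    (a := 0) (b := Real.pi)
    (F := fun (s : ℤ) θ => fourierCoeff (cosCos β) s *
      ((Real.cos (2 * s * θ) * Real.sin θ : ℝ) : ℂ))
    (f := fun θ => ((Real.cos (β * Real.cos θ) * Real.sin θ : ℝ) : ℂ))
    (fun s _ => ‖fourierCoeff (cosCos β) s‖)
    (fun s => (by fun_prop : Continuous fun θ : ℝ => fourierCoeff (cosCos β) s *
      ((Real.cos (2 * s * θ) * Real.sin θ : ℝ) : ℂ)).aestronglyMeasurable)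
    (fun s => Eventually.of_forall fun θ _ => by
      rw [norm_mul, Complex.norm_real, Real.norm_eq_abs, abs_mul]
      exact mul_le_of_le_one_right (norm_nonneg _)
        (mul_le_one₀ (Real.abs_cos_le_one _) (abs_nonneg _) (Real.abs_sin_le_one _)))
    (Eventually.of_forall fun θ _ => (summable_fourierCoeff_cosCos β).norm)
    (by simp)
    (Eventually.of_forall fun θ _ => by
      convert! (hasSum_cosCos β θ).mul_right (Real.sin θ : ℂ) using 1
      · funext s; push_cast; ring
      · push_cast; ring)
  simp only [intervalIntegral.integral_const_mul, intervalIntegral.integral_ofReal,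
    integral_cos_mul_sin, integral_cos_cos_mul_sin] at h
  convert! h.div_const 2 using 1
  · funext s; push_cast; ring
  · push_cast; ring

/-- Even frequencies alias on the Chebyshev grid to even frequencies at most `n = 2h`. -/
theorem exists_cos_alias {h : ℕ} (hh : 0 < h) (s : ℤ) : ∃ i ≤ h, ∀ k : ℕ,
    Real.cos (2 * s * (k * Real.pi / (2 * h : ℕ))) =
      Real.cos ((2 * i : ℤ) * (k * Real.pi / (2 * h : ℕ))) := by
  have hh' : (h : ℝ) ≠ 0 := by exact_mod_cast hh.ne'
  -- On the grid, `cos(2sθ)` depends only on `±s` modulo `2h`; every residue has a representative in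
  -- `[0, h]` up to sign.
  obtain ⟨i, hi, q, hq⟩ : ∃ i : ℕ, i ≤ h ∧ ∃ q : ℤ, s = i + 2 * h * q ∨ s = -i + 2 * h * q := by
    have hmod := Int.emod_add_mul_ediv s (2 * h)
    have h0 := Int.emod_nonneg s (by omega : (2 * h : ℤ) ≠ 0)
    have h1 := Int.emod_lt_of_pos s (by omega : (0 : ℤ) < 2 * h)
    by_cases hle : s % (2 * h) ≤ h
    · refine ⟨(s % (2 * h)).toNat, by omega, s / (2 * h), Or.inl ?_⟩
      rw [Int.toNat_of_nonneg h0]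
      exact hmod.symm
    · refine ⟨(2 * h - s % (2 * h)).toNat, by omega, s / (2 * h) + 1, Or.inr ?_⟩
      rw [Int.toNat_of_nonneg (by omega)]
      linear_combination -hmod
  refine ⟨i, hi, fun k => ?_⟩
  rcases hq with rfl | rfl
  · rw [← Real.cos_add_int_mul_two_pi ((2 * i : ℤ) * (k * Real.pi / (2 * h : ℕ))) (q * k)]
    congr 1
    push_cast
    field_simp
  · rw [← Real.cos_neg ((2 * i : ℤ) * (k * Real.pi / (2 * h : ℕ))),
      ← Real.cos_add_int_mul_two_pi (-((2 * i : ℤ) * (k * Real.pi / (2 * h : ℕ)))) (q * k)]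
    congr 1
    push_cast
    field_simp

theorem abs_quadrature_cos_le {h : ℕ} (hh : 2 ≤ h) (s : ℤ) :
    |1 / (1 - 4 * (s : ℝ) ^ 2) - ∑ k ∈ Finset.range (2 * h + 1), ccWeight (2 * h) k *
      Real.cos (2 * s * (k * Real.pi / (2 * h : ℕ)))| ≤
    if s.natAbs ≤ h then 0 else 36 / 35 := by
  split_ifs with hs
  · have h1 : ∀ k : ℕ, Real.cos (2 * s * (k * Real.pi / (2 * h : ℕ))) =
        Real.cos ((2 * s.natAbs : ℤ) * (k * Real.pi / (2 * h : ℕ))) := by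
      intro k
      rcases Int.natAbs_eq s with h | h
      · rw [← h]; push_cast; rfl
      · have : ((2 * s.natAbs : ℤ) : ℝ) = -(2 * s) := by
          have : (2 * s.natAbs : ℤ) = -(2 * s) := by omega
          rw [this]; push_cast; ring
        rw [this, neg_mul, Real.cos_neg]
    have h2 : ((s.natAbs : ℕ) : ℝ) ^ 2 = (s : ℝ) ^ 2 := by
      rw [Nat.cast_natAbs, Int.cast_abs, sq_abs]
    simp only [h1]
    rw [sum_ccWeight_mul_cos (by omega) hs, h2, sub_self, abs_zero]
  · obtain ⟨i, hi, halias⟩ := exists_cos_alias (by omega : 0 < h) s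
    simp only [halias]
    rw [sum_ccWeight_mul_cos (by omega) hi]
    -- From `|s| > h ≥ 2` the exact moment lies in `[-1/35, 0]`, while the aliased value lies in
    -- `[-1/3, 1]`; hence `36/35`.
    have hs3 : (9 : ℝ) ≤ (s : ℝ) ^ 2 := by
      have : 3 ≤ |s| := by rw [Int.abs_eq_natAbs]; omega
      have h3 : (3 : ℝ) ≤ |(s : ℝ)| := by exact_mod_cast this
      rw [← sq_abs]
      nlinarith
    have hA : -(1 / 35) ≤ 1 / (1 - 4 * (s : ℝ) ^ 2) ∧ 1 / (1 - 4 * (s : ℝ) ^ 2) ≤ 0 := by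
      rw [← neg_sub, div_neg]
      refine ⟨neg_le_neg (one_div_le_one_div_of_le (by norm_num) (by linarith)), ?_⟩
      exact neg_nonpos.2 (one_div_nonneg.2 (by linarith))
    have hB : -(1 / 3) ≤ 1 / (1 - 4 * (i : ℝ) ^ 2) ∧ 1 / (1 - 4 * (i : ℝ) ^ 2) ≤ 1 := by
      rcases Nat.eq_zero_or_pos i with rfl | hi0
      · norm_num
      · have : (1 : ℝ) ≤ i := by exact_mod_cast hi0
        have h4 : (3 : ℝ) ≤ 4 * (i : ℝ) ^ 2 - 1 := by nlinarith
        rw [← neg_sub, div_neg]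
        refine ⟨neg_le_neg (one_div_le_one_div_of_le (by norm_num) h4), ?_⟩
        have : 0 ≤ 1 / (4 * (i : ℝ) ^ 2 - 1) := one_div_nonneg.2 (by linarith)
        linarith
    rw [abs_le]
    constructor <;> linarith [hA.1, hA.2, hB.1, hB.2]

/-- The error of Clenshaw--Curtis quadrature for `z ↦ cos(βz)`. -/
theorem norm_sinc_sub_sum_ccWeight_le {h : ℕ} (hh : 2 ≤ h) :
    ‖(Real.sinc β : ℂ) - ∑ k ∈ Finset.range (2 * h + 1), (ccWeight (2 * h) k : ℂ) *
      Complex.exp ((β * chebyshevPoint (2 * h) k : ℝ) * Complex.I)‖ ≤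
    72 / 35 * Real.cosh (|β| * Real.sinh 1) * (Real.exp (-(2 * h)) / (Real.exp 1 ^ 2 - 1)) := by
  rw [sum_ccWeight_mul_exp (by omega)]
  have h1 : HasSum (fun s : ℤ => ∑ k ∈ Finset.range (2 * h + 1), (ccWeight (2 * h) k : ℂ) *
      (fourierCoeff (cosCos β) s * (Real.cos (2 * s * (k * Real.pi / (2 * h : ℕ))) : ℂ)))
      (∑ k ∈ Finset.range (2 * h + 1), (ccWeight (2 * h) k : ℂ) *
      (Real.cos (β * chebyshevPoint (2 * h) k) : ℂ)) :=
    hasSum_sum fun k _ => (hasSum_cosCos β _).mul_left _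
  have h2 := (hasSum_sinc β).sub h1
  have h3 : ∀ s : ℤ, fourierCoeff (cosCos β) s * ((1 / (1 - 4 * (s : ℝ) ^ 2) : ℝ) : ℂ) -
      ∑ k ∈ Finset.range (2 * h + 1), (ccWeight (2 * h) k : ℂ) *
      (fourierCoeff (cosCos β) s * (Real.cos (2 * s * (k * Real.pi / (2 * h : ℕ))) : ℂ)) =
      fourierCoeff (cosCos β) s * ((1 / (1 - 4 * (s : ℝ) ^ 2) -
        ∑ k ∈ Finset.range (2 * h + 1), ccWeight (2 * h) k *
          Real.cos (2 * s * (k * Real.pi / (2 * h : ℕ))) : ℝ) : ℂ) := by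
    intro s
    rw [Complex.ofReal_sub, mul_sub, Complex.ofReal_sum, Finset.mul_sum]
    congr 1
    refine Finset.sum_congr rfl fun k _ => ?_
    rw [Complex.ofReal_mul]
    ring
  simp only [h3] at h2
  rw [← h2.tsum_eq]
  refine tsum_of_norm_bounded
    (g := fun s : ℤ => (36 / 35 * Real.cosh (|β| * Real.sinh 1)) *
      (if s.natAbs ≤ h then 0 else Real.exp (-(2 * |(s : ℝ)|)))) ?_ fun s => ?_
  · convert! (hasSum_tail_exp h).mul_left (36 / 35 * Real.cosh (|β| * Real.sinh 1)) using 1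
    ring
  · rw [norm_mul, Complex.norm_real, Real.norm_eq_abs]
    refine (mul_le_mul (norm_fourierCoeff_cosCos_le β s) (abs_quadrature_cos_le hh s)
      (abs_nonneg _) (by positivity)).trans (le_of_eq ?_)
    split_ifs <;> ring

end ClenshawCurtis

theorem ccConst_eq : ccConst = Real.pi * Real.sinh 1 := by
  have := Real.exp_ne_zero 1
  rw [ccConst, Real.sinh_eq, Real.exp_neg]
  field_simp

/-- For `|y| ≤ 1` the cosh factor is at most `cosh(CN)`, which is `exp(CN) (1 + exp(-2CN)) / 2`; the
tail contributes `exp(-n) = exp(-νN)`. -/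
theorem norm_sinc_sub_quadrature_le {N h : ℕ} (hh : 2 ≤ h) {ν : ℝ}
    (hν : ((2 * h : ℕ) : ℝ) = ν * N) {y : ℝ} (hy : |y| ≤ 1) :
    ‖(Real.sinc (N * Real.pi * y) : ℂ) - ∑ k ∈ Finset.range (2 * h + 1),
      (ccWeight (2 * h) k : ℂ) *
      Complex.exp ((N * Real.pi * y * chebyshevPoint (2 * h) k : ℝ) * Complex.I)‖ ≤
    36 * (1 + Real.exp (-2 * ccConst * N)) / (35 * (Real.exp 1 ^ 2 - 1)) *
      Real.exp (-N * (ν - ccConst)) := by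
  refine (norm_sinc_sub_sum_ccWeight_le (N * Real.pi * y) hh).trans ?_
  have hE : 0 < Real.exp 1 ^ 2 - 1 := by
    have : 1 < Real.exp 1 := Real.one_lt_exp_iff.2 one_pos
    nlinarith
  have hs : 0 < Real.sinh 1 := Real.sinh_pos_iff.2 one_pos
  have hM : Real.cosh (|N * Real.pi * y| * Real.sinh 1) ≤ Real.cosh (ccConst * N) := by
    rw [Real.cosh_le_cosh, ccConst_eq, abs_mul, abs_abs, abs_mul, abs_mul, abs_mul, abs_mul,
      abs_of_pos Real.pi_pos, Nat.abs_cast, abs_of_pos hs]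
    calc (N : ℝ) * Real.pi * |y| * Real.sinh 1 ≤ N * Real.pi * 1 * Real.sinh 1 := by gcongr
      _ = Real.pi * Real.sinh 1 * N := by ring
  have e1 : Real.exp (-N * (ν - ccConst)) = Real.exp (ccConst * N) * Real.exp (-(2 * h)) := by
    rw [← Real.exp_add]
    congr 1
    push_cast at hν
    linear_combination hν
  have e2 : Real.cosh (ccConst * N) =
      Real.exp (ccConst * N) * (1 + Real.exp (-2 * ccConst * N)) / 2 := by
    rw [Real.cosh_eq, mul_add, ← Real.exp_add]
    ring_nf
  have e3 : 72 / 35 * Real.cosh (ccConst * N) *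
      (Real.exp (-(2 * h)) / (Real.exp 1 ^ 2 - 1)) =
      36 * (1 + Real.exp (-2 * ccConst * N)) / (35 * (Real.exp 1 ^ 2 - 1)) *
      Real.exp (-N * (ν - ccConst)) := by
    rw [e1, e2]
    field_simp
    ring
  rw [← e3]
  gcongr

/-! ### Error of the fast sinc transform -/

theorem errorFactor_nonneg {N N₁ m₁ m₂ : ℕ} {σ₁ σ₂ : ℝ} {ω₁ ω₂ : ℝ → ℝ} (hN : 1 ≤ N)
    (hσ₁ : 1 < σ₁) (hm₁ : 0 < m₁) (hN₁ : (N₁ : ℝ) = σ₁ * N) (hω₁ : IsWindowGenerator m₁ σ₁ ω₁) :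
    0 ≤ errorFactor ω₁ ω₂ m₁ m₂ N N₁ σ₁ σ₂ := by
  have hN0 : (0 : ℝ) < N := by exact_mod_cast hN
  have hpos := hω₁.evenFourier_window_pos hm₁ hσ₁ hN hN₁ (w := N / 2) ⟨by linarith, le_rfl⟩
  have h1 : 0 ≤ (errorConstant ω₁ m₁ σ₁).toReal := ENNReal.toReal_nonneg
  have h2 : 0 ≤ (errorConstant ω₂ m₂ σ₂).toReal := ENNReal.toReal_nonneg
  rw [errorFactor]
  positivity

theorem chebyshevPoint_div_two_mem (n j : ℕ) :
    chebyshevPoint n j / 2 ∈ Set.Icc (-1 / 2 : ℝ) (1 / 2) := by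
  have h1 := Real.neg_one_le_cos (j * Real.pi / n)
  have h2 := Real.cos_le_one (j * Real.pi / n)
  rw [chebyshevPoint]
  constructor <;> linarith

/-- The quadrature replaces `b - a k ∈ [-1, 1]` by products of exponentials in `a k` and `b`, and
each exponential sum is then an NNFFT target. Nonnegative weights with sum `1` pass the errors
through unamplified. -/
theorem norm_sincTransform_sub_le
    {N N₁ N₂ m₁ m₂ L₁ : ℕ} {σ₁ σ₂ : ℝ} {ω₁ ω₂ : ℝ → ℝ}
    (hN : 1 ≤ N) (hσ₁ : 1 < σ₁) (hσ₂ : 1 < σ₂) (hm₁ : 0 < m₁) (hm₂ : 0 < m₂)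
    (hN₁ : (N₁ : ℝ) = σ₁ * N) (hN₁even : Even N₁)
    (hN₂ : (N₂ : ℝ) = σ₂ * (N₁ + 2 * m₁)) (hN₂even : Even N₂)
    (hm₂N₂ : 2 * (m₂ : ℝ) ≤ (1 - 1 / σ₁) * N₂)
    (hω₁ : IsWindowGenerator m₁ σ₁ ω₁) (hω₂ : IsWindowGenerator m₂ σ₂ ω₂)
    (c : ℤ → ℂ) (a : ℤ → ℝ) {b : ℝ}
    (ha : ∀ k ∈ indexSet L₁, a k ∈ Set.Icc (-1 / 2 : ℝ) (1 / 2))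
    (hb : b ∈ Set.Icc (-1 / 2 : ℝ) (1 / 2)) {ε : ℝ} {h : ℕ} (hh : 2 ≤ h) {ν : ℝ}
    (hν : ((2 * h : ℕ) : ℝ) = ν * N)
    (hbound : 36 * (1 + Real.exp (-2 * ccConst * N)) / (35 * (Real.exp 1 ^ 2 - 1)) *
      Real.exp (-N * (ν - ccConst)) ≤ ε) {K : ℝ}
    (hK : K = errorFactor ω₁ ω₂ m₁ m₂ N N₁ σ₁ σ₂) :
    ‖sincTransform N L₁ c a b -
      fastSincTransform ω₁ ω₂ m₁ m₂ N N₁ N₂ σ₁ (2 * h) L₁ c a b‖ ≤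
      (ε + 2 * K + K ^ 2) * ∑ k ∈ indexSet L₁, ‖c k‖ := by
  have hK0 : 0 ≤ K := hK ▸ errorFactor_nonneg hN hσ₁ hm₁ hN₁ hω₁
  set n := 2 * h with hn
  set A := ∑ k ∈ indexSet L₁, ‖c k‖ with hA
  set z := chebyshevPoint n
  set w := ccWeight n
  have hw0 : ∀ j, 0 ≤ w j := fun j => ccWeight_nonneg (by omega) j
  have hwsum : ∑ j ∈ Finset.range (n + 1), w j = 1 := sum_ccWeight (by omega)
  set gt : ℕ → ℂ := fun j => nnfft ω₁ ω₂ m₁ m₂ N N₁ N₂ σ₁ (indexSet L₁) c a (z j / 2) with hgt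
  set g : ℕ → ℂ := fun j => ∑ k ∈ indexSet L₁,
    c k * Complex.exp (-2 * Real.pi * Complex.I * (N * (z j / 2) : ℝ) * a k) with hg
  have hA0 : 0 ≤ A := Finset.sum_nonneg fun _ _ => norm_nonneg _
  have hgdiff : ∀ j, ‖gt j - g j‖ ≤ K * A := fun j => hK ▸
    norm_nnfft_sub_le hN hσ₁ hσ₂ hm₁ hm₂ hN₁ hN₁even hN₂ hN₂even hm₂N₂ hω₁ hω₂ (indexSet L₁) c a
      ha (chebyshevPoint_div_two_mem n j)
  have hgnorm : ∀ j, ‖g j‖ ≤ A := fun j => norm_sum_le_of_le _ fun k _ => by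
    rw [norm_mul, norm_exp_two_pi_mul, mul_one]
  -- The second NNFFT acts on already perturbed data; this bound is the origin of the term `K ^ 2`.
  have hgtnorm : ∀ j, ‖gt j‖ ≤ (1 + K) * A := fun j => by
    have := norm_add_le (gt j - g j) (g j)
    rw [sub_add_cancel] at this
    linarith [hgdiff j, hgnorm j]
  set e : ℕ → ℂ := fun j => Complex.exp (-2 * Real.pi * Complex.I * (N * b : ℝ) * (-z j / 2 : ℝ))
    with he
  have henorm : ∀ j, ‖e j‖ = 1 := fun j => norm_exp_two_pi_mul _ _
  have hstep3 : ‖fastSincTransform ω₁ ω₂ m₁ m₂ N N₁ N₂ σ₁ n L₁ c a b -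
      ∑ j ∈ Finset.range (n + 1), (w j : ℂ) * gt j * e j‖ ≤ K * ((1 + K) * A) := by
    have h1 := norm_nnfft_sub_le (σ₂ := σ₂) hN hσ₁ hσ₂ hm₁ hm₂ hN₁ hN₁even hN₂ hN₂even hm₂N₂ hω₁ hω₂
      (Finset.range (n + 1)) (fun j => (w j : ℂ) * gt j) (fun j => -z j / 2)
      (fun j _ => by
        have := chebyshevPoint_div_two_mem n j
        exact ⟨by linarith [this.2], by linarith [this.1]⟩) hb
    rw [← hK] at h1
    refine h1.trans (mul_le_mul_of_nonneg_left ?_ hK0)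
    have h2 : ∀ j ∈ Finset.range (n + 1), ‖(w j : ℂ) * gt j‖ ≤ w j * ((1 + K) * A) := by
      intro j _
      rw [norm_mul, Complex.norm_real, Real.norm_of_nonneg (hw0 j)]
      exact mul_le_mul_of_nonneg_left (hgtnorm j) (hw0 j)
    refine (Finset.sum_le_sum h2).trans (le_of_eq ?_)
    rw [← Finset.sum_mul, hwsum, one_mul]
  have hstep2 : ‖∑ j ∈ Finset.range (n + 1), (w j : ℂ) * gt j * e j -
      ∑ j ∈ Finset.range (n + 1), (w j : ℂ) * g j * e j‖ ≤ K * A := by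
    rw [← Finset.sum_sub_distrib]
    have h2 : ∀ j ∈ Finset.range (n + 1),
        ‖(w j : ℂ) * gt j * e j - (w j : ℂ) * g j * e j‖ ≤ w j * (K * A) := by
      intro j _
      rw [← sub_mul, ← mul_sub, norm_mul, henorm, mul_one, norm_mul, Complex.norm_real,
        Real.norm_of_nonneg (hw0 j)]
      exact mul_le_mul_of_nonneg_left (hgdiff j) (hw0 j)
    refine (norm_sum_le_of_le _ h2).trans (le_of_eq ?_)
    rw [← Finset.sum_mul, hwsum, one_mul]
  have hstep1 : ‖sincTransform N L₁ c a b -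
      ∑ j ∈ Finset.range (n + 1), (w j : ℂ) * g j * e j‖ ≤ ε * A := by
    have h1 : ∑ j ∈ Finset.range (n + 1), (w j : ℂ) * g j * e j =
        ∑ k ∈ indexSet L₁, c k * ∑ j ∈ Finset.range (n + 1), (w j : ℂ) *
          Complex.exp ((N * Real.pi * (b - a k) * z j : ℝ) * Complex.I) := by
      simp only [hg, Finset.mul_sum, Finset.sum_mul]
      rw [Finset.sum_comm]
      refine Finset.sum_congr rfl fun k _ => Finset.sum_congr rfl fun j _ => ?_
      have h2 : (((N * Real.pi * (b - a k) * z j : ℝ) : ℂ) * Complex.I) =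
          -2 * Real.pi * Complex.I * (N * (z j / 2) : ℝ) * a k +
          -2 * Real.pi * Complex.I * (N * b : ℝ) * (-z j / 2 : ℝ) := by
        push_cast; ring
      rw [h2, Complex.exp_add]
      ring
    rw [h1, sincTransform, ← Finset.sum_sub_distrib, hA, Finset.mul_sum]
    refine norm_sum_le_of_le _ fun k hk => ?_
    rw [← mul_sub, norm_mul, mul_comm]
    refine mul_le_mul_of_nonneg_right ?_ (norm_nonneg _)
    have hak := ha k hk
    exact (norm_sinc_sub_quadrature_le hh hν
      (abs_le.2 ⟨by linarith [hb.1, hak.2], by linarith [hb.2, hak.1]⟩)).trans hbound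
  have hsplit : sincTransform N L₁ c a b -
      fastSincTransform ω₁ ω₂ m₁ m₂ N N₁ N₂ σ₁ n L₁ c a b =
      (sincTransform N L₁ c a b - ∑ j ∈ Finset.range (n + 1), (w j : ℂ) * g j * e j) -
      (∑ j ∈ Finset.range (n + 1), (w j : ℂ) * gt j * e j -
        ∑ j ∈ Finset.range (n + 1), (w j : ℂ) * g j * e j) -
      (fastSincTransform ω₁ ω₂ m₁ m₂ N N₁ N₂ σ₁ n L₁ c a b -
      ∑ j ∈ Finset.range (n + 1), (w j : ℂ) * gt j * e j) := by ring
  rw [hsplit]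
  refine (norm_sub_le _ _).trans ((add_le_add (norm_sub_le _ _) le_rfl).trans ?_)
  linarith [add_le_add (add_le_add hstep1 hstep2) hstep3]

end

end FastSinc

theorem mainTheorem3
    (N N₁ N₂ m₁ m₂ L₁ L₂ : ℕ) (σ₁ σ₂ : ℝ) (ω₁ ω₂ : ℝ → ℝ)
    (hN : 1 ≤ N) (hL₁ : Even L₁) (hL₂ : Even L₂)
    (hσ₁ : 1 < σ₁) (hσ₂ : 1 < σ₂) (hm₁ : 2 ≤ m₁) (hm₂ : 2 ≤ m₂)
    (hN₁ : (N₁ : ℝ) = σ₁ * N) (hN₁even : Even N₁)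
    (hN₂ : (N₂ : ℝ) = σ₂ * (N₁ + 2 * m₁)) (hN₂even : Even N₂)
    (hm₂N₂ : 2 * (m₂ : ℝ) ≤ (1 - 1 / σ₁) * N₂)
    (hω₁ : FastSinc.IsWindowGenerator m₁ σ₁ ω₁) (hω₂ : FastSinc.IsWindowGenerator m₂ σ₂ ω₂)
    (c : ℤ → ℂ) (a b : ℤ → ℝ)
    (ha : ∀ k ∈ FastSinc.indexSet L₁, a k ∈ Set.Icc (-1 / 2 : ℝ) (1 / 2))
    (hb : ∀ l ∈ FastSinc.indexSet L₂, b l ∈ Set.Icc (-1 / 2 : ℝ) (1 / 2))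
    (ε : ℝ) (hε : 0 < ε) (t n : ℕ) (ht : 2 ≤ t) (hn : n = 2 ^ t)
    (ν : ℝ) (hν : (n : ℝ) = ν * N) (hνC : FastSinc.ccConst < ν)
    (hbound : 36 * (1 + Real.exp (-2 * FastSinc.ccConst * N)) / (35 * (Real.exp 1 ^ 2 - 1)) *
      Real.exp (-N * (ν - FastSinc.ccConst)) < ε)
    (K : ℝ) (hK : K = FastSinc.errorFactor ω₁ ω₂ m₁ m₂ N N₁ σ₁ σ₂) :
    FastSinc.errorConstant ω₁ m₁ σ₁ ≠ ⊤ ∧ FastSinc.errorConstant ω₂ m₂ σ₂ ≠ ⊤ ∧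
    (∀ l ∈ FastSinc.indexSet L₂,
      ‖FastSinc.sincTransform N L₁ c a (b l) -
          FastSinc.fastSincTransform ω₁ ω₂ m₁ m₂ N N₁ N₂ σ₁ n L₁ c a (b l)‖ ≤
        (ε + 2 * K + K ^ 2) * ∑ k ∈ FastSinc.indexSet L₁, ‖c k‖) ∧
    (K ≤ 1 → ∀ l ∈ FastSinc.indexSet L₂,
      ‖FastSinc.sincTransform N L₁ c a (b l) -
          FastSinc.fastSincTransform ω₁ ω₂ m₁ m₂ N N₁ N₂ σ₁ n L₁ c a (b l)‖ ≤
        (ε + 3 * K) * ∑ k ∈ FastSinc.indexSet L₁, ‖c k‖) := by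
  have hm₁' : 0 < m₁ := by omega
  have hm₂' : 0 < m₂ := by omega
  have hK0 : 0 ≤ K := hK ▸ FastSinc.errorFactor_nonneg hN hσ₁ hm₁' hN₁ hω₁
  obtain ⟨h, hh, rfl⟩ : ∃ h, 2 ≤ h ∧ n = 2 * h := by
    obtain ⟨s, rfl⟩ : ∃ s, t = s + 2 := ⟨t - 2, by omega⟩
    refine ⟨2 ^ (s + 1), ?_, by rw [hn]; ring⟩
    rw [pow_succ]
    have := Nat.one_le_two_pow (n := s)
    omega
  have hmain : ∀ l ∈ FastSinc.indexSet L₂,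
      ‖FastSinc.sincTransform N L₁ c a (b l) -
          FastSinc.fastSincTransform ω₁ ω₂ m₁ m₂ N N₁ N₂ σ₁ (2 * h) L₁ c a (b l)‖ ≤
        (ε + 2 * K + K ^ 2) * ∑ k ∈ FastSinc.indexSet L₁, ‖c k‖ := fun l hl =>
    FastSinc.norm_sincTransform_sub_le hN hσ₁ hσ₂ hm₁' hm₂' hN₁ hN₁even hN₂ hN₂even hm₂N₂ hω₁ hω₂
      c a ha (hb l hl) hh hν hbound.le hK
  refine ⟨hω₁.errorConstant_ne_top hm₁' hσ₁, hω₂.errorConstant_ne_top hm₂' hσ₂, hmain,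
    fun hK1 l hl => (hmain l hl).trans (mul_le_mul_of_nonneg_right ?_ ?_)⟩
  -- With `0 ≤ K ≤ 1` one has `K ^ 2 ≤ K`.
  · nlinarith
  · exact Finset.sum_nonneg fun _ _ => norm_nonneg _
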